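/- **Setting.** Let $M=\mathbb R^+\times\mathbb R$ with coordinates $(x^1,x^2)$, $x^1>0$. For $\xi=(\xi_1,\dots,\xi_8)\in\mathbb R^8$ let the Type $\mathcal B$ model $\mathcal N(\xi)$ be $M$ with the connection whose Christoffel symbols are $\Gamma_{ij}^k=A_{ij}^k/x^1$, where $(A_{11}^1,A_{11}^2,A_{12}^1,A_{12}^2,A_{21}^1,A_{21}^2,A_{22}^1,A_{22}^2)=\xi$; its torsion is $T=(T^1,T^2)$, $T^k=\frac12(A_{12}^k-A_{21}^k)$ (possibly $0$). Let $\mathfrak K(\mathcal N)$ be the real vector space of smooth vector fields $v^1\partial_1+v^2\partial_2$ on $M$ which satisfy the affine Killing equations, for $1\le i,j,k\le2$ (sum over $l$): $$\partial_i\partial_jv^k+v^l\partial_l\Gamma_{ij}^k-\Gamma_{ij}^l\partial_lv^k+\Gamma_{il}^k\partial_jv^l+\Gamma_{lj}^k\partial_iv^l=0 .$$ Two Type $\mathcal B$ models are *linearly equivalent* if one is the push-forward of the other under a shear $(x^1,x^2)\mapsto(x^1,bx^1+ax^2)$ with $a,b\in\mathbb R$, $a\neq0$; that is, $\xi,\tilde\xi$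 lie in one orbit of the induced linear action on $\mathbb R^8$. Put $X=x^1\partial_1+x^2\partial_2$. **Lemma.** Every Type $\mathcal B$ model with $\dim\mathfrak K>2$ is linearly equivalent to a member of one of the families (1)–(14) below with parameters and $T$ among those listed in its "listed $T$" entry; every Type $\mathcal B$ model which is not linearly equivalent to such a member has $\mathfrak K=\operatorname{span}\{X,\partial_2\}$. In each family, the vector fields given are a basis of $\mathfrak K$ for the listed $T$, and $\{X,\partial_2\}$ is a basis of $\mathfrak K$ for every other $T\in\mathbb R^2$. 1. $\mathcal N_0^6(T)=\mathcal N(0,0,T^1,T^2,-T^1,-T^2,0,0)$. Listed $T$: $T^1=0$. - $T=0$: $\partial_1,\ \partial_2,\ x^1\partial_1,\ x^1\partial_2,\ x^2\partial_1,\ x^2\partial_2$. - $T^1=0\ne T^2$: $X,\ \partial_2,\ x^1\partial_2,\ x^2\partial_2$. 2. $\mathcal N_1^6(\pm;T)=\mathcal N(1,0,T^1,T^2,-T^1,-T^2,\pm1,0)$. Listed $T$: $T=0$. - $X,\ \partial_2,\ \frac1{x^1}\partial_1,\ \frac{x^2}{x^1}\partial_1,\ \frac{(x^1)^2\pm(x^2)^2}{x^1}\partial_1,\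 \frac{-x^2((x^2)^2\pm(x^1)^2)}{x^1}\partial_1+((x^1)^2\pm(x^2)^2)\partial_2$. 3. $\mathcal N_2^6(c;T)=\mathcal N(-1+c,0,T^1,c+T^2,-T^1,c-T^2,0,0)$, $c\ne0$. Listed $T$: $T^1=0$; and, if $c=-\frac12$, also $T^2=0$. - $T=0$: $x^1\partial_1,\ x^2\partial_2,\ \partial_2,\ (x^1)^{-c}\partial_2,\ (x^1)^{-c}(x^1\partial_1-cx^2\partial_2),\ x^2(x^1\partial_1-cx^2\partial_2)$. - $T^1=0\ne T^2$: $X,\ \partial_2,\ x^2\partial_2,\ (x^1)^{-c}\partial_2$. - $c=-\frac12$, $T^1\ne0=T^2$: $X,\ \partial_2,\ x^2(x^1\partial_1+\frac12x^2\partial_2)$. 4. $\mathcal N_3^6(T)=\mathcal N(-2,1,T^1,-1+T^2,-T^1,-1-T^2,0,0)$. Listed $T$: $T^1=0$. - $T=0$: $X,\ \partial_2,\ x^1\partial_2,\ (x^2+x^1\log x^1)\partial_2,\ -(x^1)^2\partial_1+x^1(x^1-x^2)\partial_2,\ (x^2+x^1\log x^1)(-x^1\partial_1+(x^1-x^2)\partial_2)$.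 - $T^1=0\ne T^2$: $X,\ \partial_2,\ x^1\partial_2,\ (x^2+x^1\log x^1)\partial_2$. 5. $\mathcal N_4^6(T)=\mathcal N(0,1,T^1,T^2,-T^1,-T^2,0,0)$. Listed $T$: $T^1=0$. - $T=0$: $X,\ \partial_2,\ x^1\partial_2,\ (x^2+x^1\log x^1)\partial_2,\ \partial_1-(1+\log x^1)\partial_2,\ (x^2+x^1\log x^1)(\partial_1-(1+\log x^1)\partial_2)$. - $T^1=0\ne T^2$: $X,\ \partial_2,\ x^1\partial_2,\ (x^2+x^1\log x^1)\partial_2$. 6. $\mathcal N_5^6(T)=\mathcal N(-1,0,T^1,T^2,-T^1,-T^2,0,0)$. Listed $T$: $T^1=0$. - $T=0$: $X,\ \partial_2,\ x^2\partial_2,\ x^1x^2\partial_1,\ \log x^1\,\partial_2,\ x^1\log x^1\,\partial_1$. - $T^1=0\ne T^2$: $X,\ \partial_2,\ x^2\partial_2,\ \log x^1\,\partial_2$. 7. $\mathcal N_6^6(c;T)=\mathcal N(c,0,T^1,T^2,-T^1,-T^2,0,0)$, $c\ne0,-1$. Listed $T$: $T^1=0$. - $T=0$: $X,\ \partial_2,\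 x^2\partial_2,\ (x^1)^{-c}\partial_1,\ (x^1)^{-c}x^2\partial_1,\ (x^1)^{c+1}\partial_2$. - $T^1=0\ne T^2$: $X,\ \partial_2,\ x^2\partial_2,\ (x^1)^{c+1}\partial_2$. 8. $\mathcal N_1^4(\kappa;T)=\mathcal N(2\kappa,1,T^1,T^2+\kappa,-T^1,-T^2+\kappa,0,0)$, $\kappa\ne0,-1$. Listed $T$: $T^1=0$. - $X,\ \partial_2,\ x^1\partial_2,\ x^1(\partial_1-\log x^1\,\partial_2)$. 9. $\mathcal N_2^4(\kappa,\theta;T)=\mathcal N(-1+\theta+2\kappa,0,T^1,T^2+\kappa,-T^1,-T^2+\kappa,0,0)$, $\theta\ne0$, $\kappa(\kappa+\theta)\ne0$. Listed $T$: $T^1=0$. - $X,\ \partial_2,\ x^2\partial_2,\ (x^1)^\theta\partial_2$. 10. $\mathcal N_3^4(c;T)=\mathcal N(2c-1,0,T^1,T^2+c,-T^1,-T^2+c,0,0)$, $c\ne0$. Listed $T$: $T^1=0$. - $X,\ \partial_2,\ x^2\partial_2,\ \log x^1\,\partial_2$. 11. $\mathcal N_1^3(\pm;T)=\mathcal N(-\frac32,0,T^1,-\frac12+T^2,-T^1,-\frac12-T^2,\pm\frac12,0)$.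 Listed $T$: $T^2=0$. - $X,\ \partial_2,\ x^2(2x^1\partial_1+x^2\partial_2)$. 12. $\mathcal N_2^3(c;T)=\mathcal N(-\frac32,0,1+T^1,-\frac12+T^2,1-T^1,-\frac12-T^2,c,2)$, $c\in\mathbb R$. Listed $T$: $T^2=0$. - $X,\ \partial_2,\ x^2(2x^1\partial_1+x^2\partial_2)$. 13. $\mathcal N_3^3(T)=\mathcal N(-1,0,T^1,-1+T^2,-T^1,-1-T^2,-1,0)$ (for $T=0$ the Lorentzian hyperbolic plane). Listed $T$: $T=0$. - $X,\ \partial_2,\ 2x^1x^2\partial_1+((x^2)^2+(x^1)^2)\partial_2$. 14. $\mathcal N_4^3(T)=\mathcal N(-1,0,T^1,-1+T^2,-T^1,-1-T^2,1,0)$ (for $T=0$ the hyperbolic plane). Listed $T$: $T=0$. - $X,\ \partial_2,\ 2x^1x^2\partial_1+((x^2)^2-(x^1)^2)\partial_2$. -/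

import Mathlib

open scoped ContDiff

/-- The half plane `ℝ⁺ × ℝ`, with coordinates `x¹ = p 0 > 0` and `x² = p 1`. -/
def halfPlane : Set (Fin 2 → ℝ) := {p | 0 < p 0}

theorem isOpen_halfPlane : IsOpen halfPlane :=
  isOpen_lt continuous_const (continuous_apply 0)

/-- Vector fields `v¹ ∂₁ + v² ∂₂` on the half plane, through their components `v k = v p k`. -/
abbrev VectorField : Type := halfPlane → Fin 2 → ℝ

open Classical in
/-- Extension by `0` of a function on the (open) half plane to the whole plane. It is only ever
evaluated or differentiated at points of the half plane, so the value outside is immaterial. -/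
noncomputable def extendZero (f : halfPlane → ℝ) : (Fin 2 → ℝ) → ℝ :=
  fun p => if h : p ∈ halfPlane then f ⟨p, h⟩ else 0

/-- The `k`-th component of a vector field, as a function on the plane. -/
noncomputable def component (v : VectorField) (k : Fin 2) : (Fin 2 → ℝ) → ℝ :=
  extendZero fun p => v p k

/-- The partial derivative `∂f / ∂xⁱ`. -/
noncomputable def pderiv (i : Fin 2) (f : (Fin 2 → ℝ) → ℝ) : (Fin 2 → ℝ) → ℝ :=
  fun p => fderiv ℝ f p (Pi.single i 1)

/-- A family of eight real numbers indexed by `i j k`, written `A i j k = A_{ij}^k`. -/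
abbrev Coeffs : Type := Fin 2 → Fin 2 → Fin 2 → ℝ

/-- The Christoffel symbols `Γ_{ij}^k = A_{ij}^k / x¹` of the Type B model with coefficients `A`. -/
noncomputable def christoffel (A : Coeffs) (i j k : Fin 2) : (Fin 2 → ℝ) → ℝ :=
  fun p => A i j k / p 0

/-- The left hand side, in the `i j k` component, of the affine Killing equations: the Lie derivative
of the connection with Christoffel symbols `Γ` (possibly with torsion) along the vector field
with components `v`. -/
noncomputable def killingExpr (Γ : Fin 2 → Fin 2 → Fin 2 → (Fin 2 → ℝ) → ℝ)
    (v : Fin 2 → (Fin 2 → ℝ) → ℝ) (i j k : Fin 2) (p : Fin 2 → ℝ) : ℝ :=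
  pderiv i (pderiv j (v k)) p
    + ∑ l, (v l p * pderiv l (Γ i j k) p - Γ i j l p * pderiv l (v k) p
        + Γ i l k p * pderiv j (v l) p + Γ l j k p * pderiv i (v l) p)

/-- A smooth vector field on the half plane which satisfies the eight affine Killing equations
of the Type B model with coefficients `A`. -/
def IsAffineKilling (A : Coeffs) (v : VectorField) : Prop :=
  (∀ k, ContDiffOn ℝ ∞ (component v k) halfPlane) ∧
    ∀ i j k, ∀ p ∈ halfPlane, killingExpr (christoffel A) (component v) i j k p = 0

theorem component_zero (k : Fin 2) : component 0 k = 0 := by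
  funext p
  simp [component, extendZero]

theorem component_add (v w : VectorField) (k : Fin 2) :
    component (v + w) k = component v k + component w k := by
  funext p
  by_cases h : p ∈ halfPlane <;> simp [component, extendZero, h]

theorem component_smul (c : ℝ) (v : VectorField) (k : Fin 2) :
    component (c • v) k = c • component v k := by
  funext p
  by_cases h : p ∈ halfPlane <;> simp [component, extendZero, h]

theorem differentiableAt_of_smooth {f : (Fin 2 → ℝ) → ℝ} (hf : ContDiffOn ℝ ∞ f halfPlane)
    {p : Fin 2 → ℝ} (hp : p ∈ halfPlane) : DifferentiableAt ℝ f p :=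
  (hf.contDiffAt (isOpen_halfPlane.mem_nhds hp)).differentiableAt (by simp)

theorem contDiffOn_pderiv {f : (Fin 2 → ℝ) → ℝ} (hf : ContDiffOn ℝ ∞ f halfPlane) (i : Fin 2) :
    ContDiffOn ℝ ∞ (pderiv i f) halfPlane :=
  (hf.fderiv_of_isOpen isOpen_halfPlane (by simp)).clm_apply contDiffOn_const

theorem pderiv_add {f g : (Fin 2 → ℝ) → ℝ} (i : Fin 2) {p : Fin 2 → ℝ}
    (hf : DifferentiableAt ℝ f p) (hg : DifferentiableAt ℝ g p) :
    pderiv i (f + g) p = pderiv i f p + pderiv i g p := by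
  simp [pderiv, fderiv_add hf hg]

theorem pderiv_smul (c : ℝ) (f : (Fin 2 → ℝ) → ℝ) (i : Fin 2) :
    pderiv i (c • f) = c • pderiv i f := by
  funext p
  simp [pderiv, fderiv_const_smul_field]

theorem pderiv_pderiv_add {f g : (Fin 2 → ℝ) → ℝ} (i j : Fin 2)
    (hf : ContDiffOn ℝ ∞ f halfPlane) (hg : ContDiffOn ℝ ∞ g halfPlane)
    {p : Fin 2 → ℝ} (hp : p ∈ halfPlane) :
    pderiv i (pderiv j (f + g)) p = pderiv i (pderiv j f) p + pderiv i (pderiv j g) p := by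
  rw [← pderiv_add i (differentiableAt_of_smooth (contDiffOn_pderiv hf j) hp)
    (differentiableAt_of_smooth (contDiffOn_pderiv hg j) hp)]
  have h : pderiv j (f + g) =ᶠ[nhds p] pderiv j f + pderiv j g := by
    filter_upwards [isOpen_halfPlane.mem_nhds hp] with q hq
    exact pderiv_add j (differentiableAt_of_smooth hf hq) (differentiableAt_of_smooth hg hq)
  simp only [pderiv] at h ⊢
  rw [h.fderiv_eq]

/-- The real vector space `𝔎` of affine Killing vector fields of the Type B model with
coefficients `A`. -/
noncomputable def killing (A : Coeffs) : Submodule ℝ VectorField where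
  carrier := {v | IsAffineKilling A v}
  zero_mem' := by
    refine ⟨fun k => ?_, fun i j k p _ => ?_⟩
    · rw [component_zero]
      exact contDiffOn_const
    · have h0 : ∀ i, pderiv i (0 : (Fin 2 → ℝ) → ℝ) = 0 := by
        intro i
        funext q
        simp [pderiv]
      simp [killingExpr, component_zero, h0]
  add_mem' := by
    rintro v w ⟨hv, hv'⟩ ⟨hw, hw'⟩
    refine ⟨fun k => ?_, fun i j k p hp => ?_⟩
    · rw [component_add]
      exact (hv k).add (hw k)
    · have e1 := hv' i j k p hp
      have e2 := hw' i j k p hp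
      simp only [killingExpr, component_add, pderiv_pderiv_add i j (hv k) (hw k) hp,
        pderiv_add _ (differentiableAt_of_smooth (hv _) hp) (differentiableAt_of_smooth (hw _) hp),
        Fin.sum_univ_two, Pi.add_apply] at e1 e2 ⊢
      linear_combination e1 + e2
  smul_mem' := by
    rintro c v ⟨hv, hv'⟩
    refine ⟨fun k => ?_, fun i j k p hp => ?_⟩
    · rw [component_smul]
      exact contDiffOn_const.smul (hv k)
    · have e1 := hv' i j k p hp
      simp only [killingExpr, component_smul, pderiv_smul, Fin.sum_univ_two, Pi.smul_apply,
        smul_eq_mul] at e1 ⊢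
      linear_combination c * e1

/-- The listed vector fields are a basis of the space of affine Killing vector fields. -/
def HasKillingBasis (A : Coeffs) {n : ℕ} (b : Fin n → VectorField) : Prop :=
  LinearIndependent ℝ b ∧ Submodule.span ℝ (Set.range b) = killing A

/-- The matrix of the shear `(x¹, x²) ↦ (x¹, b x¹ + a x²)`. -/
def shear (a b : ℝ) : Matrix (Fin 2) (Fin 2) ℝ := !![1, 0; b, a]

/-- The push-forward of a Type B model under the shear `(x¹, x²) ↦ (x¹, b x¹ + a x²)`. The map is
linear and preserves `x¹`, so the coefficients transform as a tensor of type `(1,2)`. -/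
noncomputable def shearAct (a b : ℝ) (A : Coeffs) : Coeffs := fun i j k =>
  ∑ l, ∑ m, ∑ n, (shear a b)⁻¹ l i * (shear a b)⁻¹ m j * shear a b k n * A l m n

/-- Linear equivalence of Type B models: they lie in one orbit of the group of shears. -/
def LinearlyEquivalent (A B : Coeffs) : Prop :=
  ∃ a b : ℝ, a ≠ 0 ∧ shearAct a b A = B

/-- The coefficients with `(A₁₁¹, A₁₁², A₁₂¹, A₁₂², A₂₁¹, A₂₁², A₂₂¹, A₂₂²) = (ξ₁, …, ξ₈)`. -/
def typeB (ξ₁ ξ₂ ξ₃ ξ₄ ξ₅ ξ₆ ξ₇ ξ₈ : ℝ) : Coeffs :=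
  ![![![ξ₁, ξ₂], ![ξ₃, ξ₄]], ![![ξ₅, ξ₆], ![ξ₇, ξ₈]]]

/-! The families of models; the digits in `Nij` are the subscript `i` and the superscript `j`.
The parameters `T₁ T₂` are the torsion coefficients `T^k = (A₁₂ᵏ - A₂₁ᵏ) / 2`. -/

noncomputable def N06 (T₁ T₂ : ℝ) : Coeffs := typeB 0 0 T₁ T₂ (-T₁) (-T₂) 0 0

noncomputable def N16 (ε T₁ T₂ : ℝ) : Coeffs := typeB 1 0 T₁ T₂ (-T₁) (-T₂) ε 0

noncomputable def N26 (c T₁ T₂ : ℝ) : Coeffs := typeB (-1 + c) 0 T₁ (c + T₂) (-T₁) (c - T₂) 0 0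

noncomputable def N36 (T₁ T₂ : ℝ) : Coeffs := typeB (-2) 1 T₁ (-1 + T₂) (-T₁) (-1 - T₂) 0 0

noncomputable def N46 (T₁ T₂ : ℝ) : Coeffs := typeB 0 1 T₁ T₂ (-T₁) (-T₂) 0 0

noncomputable def N56 (T₁ T₂ : ℝ) : Coeffs := typeB (-1) 0 T₁ T₂ (-T₁) (-T₂) 0 0

noncomputable def N66 (c T₁ T₂ : ℝ) : Coeffs := typeB c 0 T₁ T₂ (-T₁) (-T₂) 0 0

noncomputable def N14 (κ T₁ T₂ : ℝ) : Coeffs := typeB (2 * κ) 1 T₁ (T₂ + κ) (-T₁) (-T₂ + κ) 0 0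

noncomputable def N24 (κ θ T₁ T₂ : ℝ) : Coeffs :=
  typeB (-1 + θ + 2 * κ) 0 T₁ (T₂ + κ) (-T₁) (-T₂ + κ) 0 0

noncomputable def N34 (c T₁ T₂ : ℝ) : Coeffs :=
  typeB (2 * c - 1) 0 T₁ (T₂ + c) (-T₁) (-T₂ + c) 0 0

noncomputable def N13 (ε T₁ T₂ : ℝ) : Coeffs :=
  typeB (-(3 / 2)) 0 T₁ (-(1 / 2) + T₂) (-T₁) (-(1 / 2) - T₂) (ε * (1 / 2)) 0

noncomputable def N23 (c T₁ T₂ : ℝ) : Coeffs :=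
  typeB (-(3 / 2)) 0 (1 + T₁) (-(1 / 2) + T₂) (1 - T₁) (-(1 / 2) - T₂) c 2

noncomputable def N33 (T₁ T₂ : ℝ) : Coeffs := typeB (-1) 0 T₁ (-1 + T₂) (-T₁) (-1 - T₂) (-1) 0

noncomputable def N43 (T₁ T₂ : ℝ) : Coeffs := typeB (-1) 0 T₁ (-1 + T₂) (-T₁) (-1 - T₂) 1 0

/-- The models of the classification, with the values of the parameters and of the torsion
which are listed for each family. -/
def IsListed (B : Coeffs) : Prop :=
  (∃ T₂, B = N06 0 T₂) ∨
  (∃ ε, (ε = 1 ∨ ε = -1) ∧ B = N16 ε 0 0) ∨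
  (∃ c T₂, c ≠ 0 ∧ B = N26 c 0 T₂) ∨
  (∃ T₁, T₁ ≠ 0 ∧ B = N26 (-(1 / 2)) T₁ 0) ∨
  (∃ T₂, B = N36 0 T₂) ∨
  (∃ T₂, B = N46 0 T₂) ∨
  (∃ T₂, B = N56 0 T₂) ∨
  (∃ c T₂, c ≠ 0 ∧ c ≠ -1 ∧ B = N66 c 0 T₂) ∨
  (∃ κ T₂, κ ≠ 0 ∧ κ ≠ -1 ∧ B = N14 κ 0 T₂) ∨
  (∃ κ θ T₂, θ ≠ 0 ∧ κ * (κ + θ) ≠ 0 ∧ B = N24 κ θ 0 T₂) ∨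
  (∃ c T₂, c ≠ 0 ∧ B = N34 c 0 T₂) ∨
  (∃ ε T₁, (ε = 1 ∨ ε = -1) ∧ B = N13 ε T₁ 0) ∨
  (∃ c T₁, B = N23 c T₁ 0) ∨
  B = N33 0 0 ∨
  B = N43 0 0

/-- The vector field `f(x¹, x²) ∂₁ + g(x¹, x²) ∂₂`, where `F = (f, g)`. -/
def field (F : ℝ → ℝ → ℝ × ℝ) : VectorField := fun p =>
  ![(F (p.1 0) (p.1 1)).1, (F (p.1 0) (p.1 1)).2]

/-- The coordinate field `∂₂`. -/
def D₂ : VectorField := field fun _ _ => (0, 1)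

/-- The dilation field `X = x¹ ∂₁ + x² ∂₂`. -/
def X : VectorField := field fun x y => (x, y)

/-!
For a vector field `v` put `E_j^k = ∂ⱼ vᵏ - (v¹ / x¹) δⱼᵏ` (`reduced`), a function with values in
`𝔤𝔩₂(ℝ)`. Since the Christoffel symbols are homogeneous of degree `-1` in `x¹`, the affine Killing
equations become a linear system with constant coefficients, `x¹ ∂ᵢ E = Qᵢ E` (`pderiv_reduced`,
with `Qᵢ = prolong A i`). So `E` vanishes identically as soon as it vanishes at one point, and it
vanishes identically exactly for the combinations of `X` and `∂₂`. The values of all the `E` of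
Killing fields span a subspace `K` of `𝔤𝔩₂`, and `dim 𝔎 ≤ 2 + dim K`. This subspace is stable under
`Q₁` and `Q₂`, its elements annihilate the torsion, and the relation `[x¹ ∂₁, x¹ ∂₂] = x¹ ∂₂` becomes
`Q₂ Q₁ - Q₁ Q₂ = Q₂` on `K` (`isProlonged_reducedSpan`). All that remains is linear algebra in four
dimensions.

If `K ≠ 0`, then `Q₂` has a nonzero kernel in `K`, because `Q₂ Q₁ - Q₁ Q₂ = Q₂` with `Q₂` invertible
contradicts the trace. Either this kernel has an element with `E₂¹ = 0`, and then its images under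
`Q₁` are again such elements, or it is spanned by an element with `E₂¹ = 1` which is fixed by `Q₁`.
In both cases the resulting equations determine the model up to a shear, and the outcome is the list
(`IsProlonged.isClassified`). All other models have `K = 0`.

For the members of the families, upper bounds for `K` come from the torsion, from stability and from
the relation between `Q₁` and `Q₂`. The listed fields are elementary functions, so that the
Killing equations for them are checked with symbolic derivatives (`Elem`); their values and first
derivatives at `(1, 0)` are linearly independent and the bound on the dimension makes them a basis
(`Elem.hasKillingBasis`).
-/

/-! ### The first order system for the reduced derivative -/

/-- The space `𝔤𝔩₂(ℝ)`; for `E : Frame` the entry `E_j^k` is `E j k`. -/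
abbrev Frame : Type := Fin 2 → Fin 2 → ℝ

/-- The natural action `E ↦ E · A` of `E ∈ 𝔤𝔩₂` on the `(1,2)`-tensor `A`. -/
def tensorAct (A : Coeffs) : Frame →ₗ[ℝ] Coeffs where
  toFun E i j k := ∑ l, (A i j l * E l k - A i l k * E j l - A l j k * E i l)
  map_add' E F := by
    funext i j k
    simp only [Fin.sum_univ_two, Pi.add_apply]
    ring
  map_smul' c E := by
    funext i j k
    simp only [Fin.sum_univ_two, Pi.smul_apply, smul_eq_mul, RingHom.id_apply]
    ring

theorem tensorAct_apply (A : Coeffs) (E : Frame) (i j k : Fin 2) :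
    tensorAct A E i j k = ∑ l, (A i j l * E l k - A i l k * E j l - A l j k * E i l) := rfl

/-- The constant linear operator which expresses `x¹ ∂ᵢ` of the reduced derivative of an affine
Killing field through the reduced derivative itself. -/
def prolong (A : Coeffs) (i : Fin 2) : Frame →ₗ[ℝ] Frame where
  toFun E j k := tensorAct A E i j k - if j = k then E i 0 else 0
  map_add' E F := by
    funext j k
    simp only [map_add, Pi.add_apply]
    split_ifs <;> ring
  map_smul' c E := by
    funext j k
    simp only [map_smul, Pi.smul_apply, smul_eq_mul, RingHom.id_apply]
    split_ifs <;> ring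

theorem prolong_apply (A : Coeffs) (i : Fin 2) (E : Frame) (j k : Fin 2) :
    prolong A i E j k = tensorAct A E i j k - if j = k then E i 0 else 0 := rfl

/-- The reduced derivative `∂ⱼ vᵏ - (v¹ / x¹) δⱼᵏ` of a vector field. It vanishes identically
on `X` and on `∂₂`. -/
noncomputable def reduced (v : VectorField) (j k : Fin 2) : (Fin 2 → ℝ) → ℝ :=
  fun p => pderiv j (component v k) p - if j = k then component v 0 p / p 0 else 0

/-- The reduced derivative at a point, as an element of `𝔤𝔩₂`. -/
noncomputable def reducedAt (v : VectorField) (p : Fin 2 → ℝ) : Frame :=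
  fun j k => reduced v j k p

theorem contDiffOn_reduced {v : VectorField} (hv : ∀ k, ContDiffOn ℝ ∞ (component v k) halfPlane)
    (j k : Fin 2) : ContDiffOn ℝ ∞ (reduced v j k) halfPlane := by
  unfold reduced
  refine (contDiffOn_pderiv (hv k) j).sub ?_
  split_ifs with h
  · exact (hv 0).div (by fun_prop) fun p hp => ne_of_gt hp
  · exact contDiffOn_const

theorem pderiv_congr {f g : (Fin 2 → ℝ) → ℝ} (h : Set.EqOn f g halfPlane) (i : Fin 2)
    {p : Fin 2 → ℝ} (hp : p ∈ halfPlane) : pderiv i f p = pderiv i g p := by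
  have : f =ᶠ[nhds p] g := by
    filter_upwards [isOpen_halfPlane.mem_nhds hp] with q hq using h hq
  simp only [pderiv, this.fderiv_eq]

theorem pderiv_sub {f g : (Fin 2 → ℝ) → ℝ} (i : Fin 2) {p : Fin 2 → ℝ}
    (hf : DifferentiableAt ℝ f p) (hg : DifferentiableAt ℝ g p) :
    pderiv i (fun q => f q - g q) p = pderiv i f p - pderiv i g p := by
  simp [pderiv, fderiv_fun_sub hf hg]

theorem pderiv_coord (i j : Fin 2) (p : Fin 2 → ℝ) :
    pderiv i (fun q => q j) p = if i = j then 1 else 0 := by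
  have h : HasFDerivAt (fun q : Fin 2 → ℝ => q j)
      (ContinuousLinearMap.proj (R := ℝ) (φ := fun _ : Fin 2 => ℝ) j) p :=
    (ContinuousLinearMap.proj (R := ℝ) (φ := fun _ : Fin 2 => ℝ) j).hasFDerivAt
  rw [pderiv, h.fderiv, ContinuousLinearMap.proj_apply, Pi.single_apply]
  simp only [eq_comm]

theorem pderiv_mul {f g : (Fin 2 → ℝ) → ℝ} (i : Fin 2) {p : Fin 2 → ℝ}
    (hf : DifferentiableAt ℝ f p) (hg : DifferentiableAt ℝ g p) :
    pderiv i (fun q => f q * g q) p = pderiv i f p * g p + f p * pderiv i g p := by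
  simp [pderiv, fderiv_fun_mul hf hg]
  ring

theorem pderiv_inv_coord (i : Fin 2) {p : Fin 2 → ℝ} (hp : p ∈ halfPlane) :
    pderiv i (fun q => (q 0)⁻¹) p = if i = 0 then -(p 0)⁻¹ * (p 0)⁻¹ else 0 := by
  have hx : p 0 ≠ 0 := ne_of_gt hp
  have h : HasFDerivAt (fun q : Fin 2 → ℝ => q 0)
      (ContinuousLinearMap.proj (R := ℝ) (φ := fun _ : Fin 2 => ℝ) 0) p :=
    (ContinuousLinearMap.proj (R := ℝ) (φ := fun _ : Fin 2 => ℝ) 0).hasFDerivAt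
  have h2 := (hasDerivAt_inv hx).comp_hasFDerivAt p h
  have h3 : fderiv ℝ (fun q : Fin 2 → ℝ => (q 0)⁻¹) p = _ := h2.fderiv
  rw [pderiv, h3]
  fin_cases i <;> simp
  field_simp

theorem differentiableAt_inv_coord {p : Fin 2 → ℝ} (hp : p ∈ halfPlane) :
    DifferentiableAt ℝ (fun q : Fin 2 → ℝ => (q 0)⁻¹) p :=
  (differentiableAt_apply (𝕜 := ℝ) (0 : Fin 2) p).inv (ne_of_gt hp)

theorem pderiv_comm {f : (Fin 2 → ℝ) → ℝ} (hf : ContDiffOn ℝ ∞ f halfPlane) (i j : Fin 2)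
    {p : Fin 2 → ℝ} (hp : p ∈ halfPlane) :
    pderiv i (pderiv j f) p = pderiv j (pderiv i f) p := by
  have hfp : ContDiffAt ℝ ∞ f p := hf.contDiffAt (isOpen_halfPlane.mem_nhds hp)
  have hd : DifferentiableAt ℝ (fderiv ℝ f) p :=
    (hfp.fderiv_right (m := 1) (by norm_cast)).differentiableAt (by simp)
  have key : ∀ i j, pderiv i (pderiv j f) p
      = fderiv ℝ (fderiv ℝ f) p (Pi.single i 1) (Pi.single j 1) := by
    intro i j
    have : pderiv j f = fun q => fderiv ℝ f q (Pi.single j 1) := rfl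
    rw [this, pderiv, fderiv_clm_apply hd (differentiableAt_const _)]
    simp
  rw [key, key]
  exact hfp.isSymmSndFDerivAt
    (by rw [minSmoothness_of_isRCLikeNormedField]; exact ENat.LEInfty.out) _ _

theorem pderiv_christoffel (A : Coeffs) (l i j k : Fin 2) {p : Fin 2 → ℝ} (hp : p ∈ halfPlane) :
    pderiv l (christoffel A i j k) p = if l = 0 then -(A i j k) / p 0 ^ 2 else 0 := by
  have hx : p 0 ≠ 0 := ne_of_gt hp
  have : christoffel A i j k = A i j k • fun q : Fin 2 → ℝ => (q 0)⁻¹ := by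
    funext q
    simp [christoffel, div_eq_mul_inv]
  rw [this, pderiv_smul, Pi.smul_apply, pderiv_inv_coord l hp]
  split_ifs <;> simp
  field_simp

/-- The affine Killing equations of `v` amount to the linear system `x¹ ∂ᵢ E = prolong A i E`, with
constant coefficients, for the reduced derivative `E` of `v`. -/
theorem pderiv_reduced {A : Coeffs} {v : VectorField} (hv : IsAffineKilling A v) (i j k : Fin 2)
    {p : Fin 2 → ℝ} (hp : p ∈ halfPlane) :
    pderiv i (reduced v j k) p = (p 0)⁻¹ * prolong A i (reducedAt v p) j k := by
  have hx : p 0 ≠ 0 := ne_of_gt hp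
  have e := hv.2 i j k p hp
  have d1 : ∀ k, DifferentiableAt ℝ (component v k) p :=
    fun k => differentiableAt_of_smooth (hv.1 k) hp
  have d2 := differentiableAt_of_smooth (contDiffOn_pderiv (hv.1 k) j) hp
  have e2 : pderiv i (fun q => component v 0 q * (q 0)⁻¹) p = _ :=
    pderiv_mul i (d1 0) (differentiableAt_inv_coord hp)
  rw [pderiv_inv_coord i hp] at e2
  have e3 : pderiv i (reduced v j k) p = pderiv i (pderiv j (component v k)) p
      - if j = k then pderiv i (fun q => component v 0 q * (q 0)⁻¹) p else 0 := by
    unfold reduced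
    split_ifs with h
    · simp only [div_eq_mul_inv]
      exact pderiv_sub i d2 ((d1 0).mul (differentiableAt_inv_coord hp))
    · simp only [sub_zero]
  rw [e3, e2]
  simp only [killingExpr, Fin.sum_univ_two, pderiv_christoffel A _ _ _ _ hp] at e
  simp only [prolong_apply, tensorAct_apply, reducedAt, reduced, Fin.sum_univ_two]
  simp only [christoffel] at e
  generalize pderiv i (pderiv j (component v k)) p = H at *
  clear e2 e3 d2 d1
  revert e
  fin_cases i <;> fin_cases j <;> fin_cases k <;> simp <;> intro e <;> field_simp <;>
    field_simp at e <;> linear_combination e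

/-- As second derivatives commute, the action of the reduced derivative annihilates the torsion. -/
theorem tensorAct_symm {A : Coeffs} {v : VectorField} (hv : IsAffineKilling A v) (i j k : Fin 2)
    {p : Fin 2 → ℝ} (hp : p ∈ halfPlane) :
    tensorAct A (reducedAt v p) i j k = tensorAct A (reducedAt v p) j i k := by
  have hx : p 0 ≠ 0 := ne_of_gt hp
  have e1 := hv.2 i j k p hp
  have e2 := hv.2 j i k p hp
  rw [killingExpr, pderiv_comm (hv.1 k) i j hp] at e1
  rw [killingExpr] at e2
  simp only [Fin.sum_univ_two, pderiv_christoffel A _ _ _ _ hp, christoffel] at e1 e2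
  simp only [tensorAct_apply, reducedAt, reduced, Fin.sum_univ_two]
  revert e1 e2
  fin_cases i <;> fin_cases j <;> fin_cases k <;> simp <;> intro e1 e2 <;> field_simp <;>
    field_simp at e1 e2 <;> first | linear_combination e1 - e2 | linear_combination e2 - e1

theorem exists_hasFDerivAt_reducedAt {A : Coeffs} {v : VectorField} (hv : IsAffineKilling A v)
    {p : Fin 2 → ℝ} (hp : p ∈ halfPlane) :
    ∃ D : (Fin 2 → ℝ) →L[ℝ] Frame, HasFDerivAt (reducedAt v) D p ∧
      ∀ i, D (Pi.single i 1) = (p 0)⁻¹ • prolong A i (reducedAt v p) := by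
  refine ⟨ContinuousLinearMap.pi fun j => ContinuousLinearMap.pi fun k =>
    fderiv ℝ (reduced v j k) p, hasFDerivAt_pi.2 fun j => hasFDerivAt_pi.2 fun k =>
      (differentiableAt_of_smooth (contDiffOn_reduced hv.1 j k) hp).hasFDerivAt, fun i => ?_⟩
  funext j k
  exact pderiv_reduced hv i j k hp

/-- The relation `[x¹ ∂₁, x¹ ∂₂] = x¹ ∂₂`, read on the reduced derivative of a Killing field. -/
theorem prolong_comm {A : Coeffs} {v : VectorField} (hv : IsAffineKilling A v)
    {p : Fin 2 → ℝ} (hp : p ∈ halfPlane) :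
    prolong A 1 (prolong A 0 (reducedAt v p)) - prolong A 0 (prolong A 1 (reducedAt v p))
      = prolong A 1 (reducedAt v p) := by
  have hx : p 0 ≠ 0 := ne_of_gt hp
  -- the derivative of a linear function of the reduced derivative
  have lin : ∀ (L : Frame →ₗ[ℝ] Frame) (i j k : Fin 2),
      DifferentiableAt ℝ (fun q => L (reducedAt v q) j k) p ∧
      pderiv i (fun q => L (reducedAt v q) j k) p
        = (p 0)⁻¹ * L (prolong A i (reducedAt v p)) j k := by
    intro L i j k
    obtain ⟨D, hE, hD⟩ := exists_hasFDerivAt_reducedAt hv hp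
    let M : Frame →L[ℝ] ℝ :=
      LinearMap.toContinuousLinearMap ((LinearMap.proj k).comp ((LinearMap.proj j).comp L))
    have h2 : HasFDerivAt (fun q => L (reducedAt v q) j k) _ p := M.hasFDerivAt.comp p hE
    refine ⟨h2.differentiableAt, ?_⟩
    rw [pderiv, h2.fderiv]
    rw [ContinuousLinearMap.comp_apply, hD]
    simp [M]
  have second : ∀ i i' j k, pderiv i (pderiv i' (reduced v j k)) p
      = (if i = 0 then -(p 0)⁻¹ * (p 0)⁻¹ else 0) * prolong A i' (reducedAt v p) j k
        + (p 0)⁻¹ * ((p 0)⁻¹ * prolong A i' (prolong A i (reducedAt v p)) j k) := by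
    intro i i' j k
    rw [pderiv_congr (g := fun q => (q 0)⁻¹ * prolong A i' (reducedAt v q) j k)
        (fun q hq => pderiv_reduced hv i' j k hq) i hp,
      pderiv_mul i (differentiableAt_inv_coord hp) (lin _ i j k).1, (lin _ i j k).2,
      pderiv_inv_coord i hp]
  funext j k
  have e := pderiv_comm (contDiffOn_reduced hv.1 j k) 0 1 hp
  rw [second, second] at e
  simp only [if_true, one_ne_zero, if_false] at e
  simp only [Pi.sub_apply]
  field_simp at e
  linarith

/-! ### Unique continuation, and fields with vanishing reduced derivative -/

theorem convex_halfPlane : Convex ℝ halfPlane :=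
  (convex_Ioi (0 : ℝ)).is_linear_preimage (IsLinearMap.mk (fun _ _ => rfl) fun _ _ => rfl :
    IsLinearMap ℝ fun p : Fin 2 → ℝ => p 0)

theorem clm_apply_eq_sum_single {F : Type*} [NormedAddCommGroup F] [NormedSpace ℝ F]
    (L : (Fin 2 → ℝ) →L[ℝ] F) (w : Fin 2 → ℝ) : L w = ∑ i, w i • L (Pi.single i 1) := by
  conv_lhs => rw [← Finset.univ_sum_single w]
  rw [map_sum]
  refine Finset.sum_congr rfl fun i _ => ?_
  rw [← map_smul, ← Pi.single_smul, smul_eq_mul, mul_one]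

/-- The reduced derivative solves a linear system, hence vanishes identically if it vanishes at one
point. -/
theorem reducedAt_eq_zero {A : Coeffs} {v : VectorField} (hv : IsAffineKilling A v)
    {p₀ p : Fin 2 → ℝ} (hp₀ : p₀ ∈ halfPlane) (hp : p ∈ halfPlane) (h0 : reducedAt v p₀ = 0) :
    reducedAt v p = 0 := by
  set γ : ℝ → Fin 2 → ℝ := fun t => p₀ + t • (p - p₀) with hγ
  have hγd : ∀ t, HasDerivAt γ (p - p₀) t := fun t => by
    have h := ((hasDerivAt_id t).smul_const (p - p₀)).const_add p₀
    rw [one_smul] at h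
    exact h
  set δ := min (p₀ 0) (p 0) with hδ
  have hδ0 : 0 < δ := lt_min hp₀ hp
  have hγδ : ∀ t ∈ Set.Icc (0 : ℝ) 1, δ ≤ γ t 0 := by
    rintro t ⟨ht0, ht1⟩
    have h1 : δ ≤ p₀ 0 := min_le_left _ _
    have h2 : δ ≤ p 0 := min_le_right _ _
    simp only [hγ, Pi.add_apply, Pi.smul_apply, Pi.sub_apply, smul_eq_mul]
    nlinarith
  have hγH : ∀ t ∈ Set.Icc (0 : ℝ) 1, γ t ∈ halfPlane := fun t ht => hδ0.trans_le (hγδ t ht)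
  set Q : Frame →L[ℝ] Frame :=
    LinearMap.toContinuousLinearMap (∑ i, (p - p₀) i • prolong A i) with hQ
  have hder : ∀ t ∈ Set.Icc (0 : ℝ) 1,
      HasDerivAt (fun t => reducedAt v (γ t)) ((γ t 0)⁻¹ • Q (reducedAt v (γ t))) t := by
    intro t ht
    obtain ⟨D, hD, hDi⟩ := exists_hasFDerivAt_reducedAt hv (hγH t ht)
    have e : D (p - p₀) = (γ t 0)⁻¹ • Q (reducedAt v (γ t)) := by
      rw [clm_apply_eq_sum_single]
      simp only [hDi, hQ, LinearMap.coe_toContinuousLinearMap', LinearMap.sum_apply,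
        LinearMap.smul_apply, Finset.smul_sum]
      exact Finset.sum_congr rfl fun i _ => smul_comm _ _ _
    have h := hD.comp_hasDerivAt t (hγd t)
    rw [e] at h
    exact h
  have key := eq_zero_of_abs_deriv_le_mul_abs_self_of_eq_zero_right
    (f := fun t => reducedAt v (γ t)) (f' := fun t => (γ t 0)⁻¹ • Q (reducedAt v (γ t)))
    (K := δ⁻¹ * ‖Q‖) (a := 0) (b := 1)
    (fun t ht => (hder t ht).continuousAt.continuousWithinAt)
    (fun t ht => (hder t ⟨ht.1, ht.2.le⟩).hasDerivWithinAt) (by simpa [hγ] using h0) ?_ 1 (by simp)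
  · simpa [hγ] using key
  · intro t ht
    have hle := hγδ t ⟨ht.1, ht.2.le⟩
    have hpos := hδ0.trans_le hle
    rw [norm_smul, Real.norm_of_nonneg (inv_nonneg.2 hpos.le), mul_assoc]
    exact mul_le_mul (inv_anti₀ hδ0 hle) (Q.le_opNorm _) (norm_nonneg _) (inv_nonneg.2 hδ0.le)

theorem fderiv_eq_zero_of_pderiv {f : (Fin 2 → ℝ) → ℝ} {p : Fin 2 → ℝ}
    (h : ∀ i, pderiv i f p = 0) : fderiv ℝ f p = 0 := by
  ext w
  rw [clm_apply_eq_sum_single]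
  exact Finset.sum_eq_zero fun i _ => by
    rw [show fderiv ℝ f p (Pi.single i 1) = 0 from h i, smul_zero]

theorem exists_const_of_pderiv_eq_zero {f : (Fin 2 → ℝ) → ℝ} (hf : ContDiffOn ℝ ∞ f halfPlane)
    (h : ∀ i, ∀ p ∈ halfPlane, pderiv i f p = 0) : ∃ a, ∀ p ∈ halfPlane, f p = a :=
  isOpen_halfPlane.exists_is_const_of_fderiv_eq_zero convex_halfPlane.isPreconnected
    (hf.differentiableOn (by simp)) fun p hp => fderiv_eq_zero_of_pderiv fun i => h i p hp

theorem component_apply (v : VectorField) (k : Fin 2) (p : halfPlane) :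
    component v k p = v p k := by
  simp [component, extendZero, p.2]

/-- A smooth field with vanishing reduced derivative is a combination of `X` and `∂₂`. -/
theorem exists_eq_of_reducedAt_eq_zero {v : VectorField}
    (hv : ∀ k, ContDiffOn ℝ ∞ (component v k) halfPlane)
    (h0 : ∀ p ∈ halfPlane, reducedAt v p = 0) : ∃ a b : ℝ, v = a • X + b • D₂ := by
  have hr : ∀ p ∈ halfPlane, ∀ j k, pderiv j (component v k) p
      = if j = k then component v 0 p / p 0 else 0 := fun p hp j k => by
    have := congrFun (congrFun (h0 p hp) j) k
    simpa only [reducedAt, reduced, Pi.zero_apply, sub_eq_zero] using this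
  have hinv : ContDiffOn ℝ ∞ (fun q : Fin 2 → ℝ => (q 0)⁻¹) halfPlane :=
    ContDiffOn.inv (by fun_prop) fun q hq => ne_of_gt hq
  obtain ⟨a, ha⟩ := exists_const_of_pderiv_eq_zero (f := fun q => component v 0 q * (q 0)⁻¹)
    ((hv 0).mul hinv) (by
      intro i p hp
      have hx : p 0 ≠ 0 := ne_of_gt hp
      rw [pderiv_mul i (differentiableAt_of_smooth (hv 0) hp) (differentiableAt_inv_coord hp),
        pderiv_inv_coord i hp, hr p hp]
      fin_cases i <;> simp
      field_simp
      ring)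
  obtain ⟨b, hb⟩ := exists_const_of_pderiv_eq_zero (f := fun q => component v 1 q - a * q 1)
    ((hv 1).sub (by fun_prop)) (by
      intro i p hp
      have hx : p 0 ≠ 0 := ne_of_gt hp
      have e : pderiv i (fun q : Fin 2 → ℝ => a * q 1) p = a * if i = 1 then 1 else 0 := by
        rw [← pderiv_coord i 1 p]
        exact congrFun (pderiv_smul a (fun q : Fin 2 → ℝ => q 1) i) p
      rw [pderiv_sub i (differentiableAt_of_smooth (hv 1) hp) (by fun_prop), hr p hp, e,
        ← ha p hp]
      fin_cases i <;> simp [div_eq_mul_inv])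
  refine ⟨a, b, ?_⟩
  funext p k
  have hx : p.1 0 ≠ 0 := ne_of_gt p.2
  have h1 := ha p p.2
  have h2 := hb p p.2
  simp only [component_apply] at h1 h2
  fin_cases k
  · simp [X, D₂, field]
    field_simp at h1
    linarith
  · simp [X, D₂, field]
    linarith

/-! ### The span of the reduced derivatives -/

/-- The space of all values of the reduced derivatives of affine Killing fields (their linear span,
described through the linear functionals which vanish on all these values). -/
def reducedSpan (A : Coeffs) : Submodule ℝ Frame where
  carrier := {E | ∀ φ : Frame →ₗ[ℝ] ℝ,
    (∀ v ∈ killing A, ∀ p ∈ halfPlane, φ (reducedAt v p) = 0) → φ E = 0}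
  zero_mem' φ _ := map_zero φ
  add_mem' hE hF φ hφ := by rw [map_add, hE φ hφ, hF φ hφ, add_zero]
  smul_mem' c E hE φ hφ := by rw [map_smul, hE φ hφ, smul_zero]

theorem reducedAt_mem {A : Coeffs} {v : VectorField} (hv : v ∈ killing A) {p : Fin 2 → ℝ}
    (hp : p ∈ halfPlane) : reducedAt v p ∈ reducedSpan A := fun _ hφ => hφ v hv p hp

/-- Linear relations between the values of the reduced derivatives hold on their span. -/
theorem eq_zero_of_mem_reducedSpan {A : Coeffs} (L : Frame →ₗ[ℝ] Frame)
    (hL : ∀ v ∈ killing A, ∀ p ∈ halfPlane, L (reducedAt v p) = 0) {E : Frame}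
    (hE : E ∈ reducedSpan A) : L E = 0 := by
  funext j k
  refine hE ((LinearMap.proj k).comp ((LinearMap.proj j).comp L)) fun v hv p hp => ?_
  simp [hL v hv p hp]

/-- The properties of the span of the values of the reduced derivatives on which the
classification rests: its elements annihilate the torsion, it is stable under the two prolongation
operators, and on it these satisfy the relation `[x¹ ∂₁, x¹ ∂₂] = x¹ ∂₂` (the order of the
operators is reversed, since `x¹ ∂₁` maps `prolong A 1 E` to `prolong A 1 (prolong A 0 E)`). -/
structure IsProlonged (A : Coeffs) (K : Submodule ℝ Frame) : Prop where
  symm : ∀ E ∈ K, ∀ k, tensorAct A E 0 1 k = tensorAct A E 1 0 k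
  prolong_mem : ∀ i, ∀ E ∈ K, prolong A i E ∈ K
  comm : ∀ E ∈ K, prolong A 1 (prolong A 0 E) - prolong A 0 (prolong A 1 E) = prolong A 1 E

theorem isProlonged_reducedSpan (A : Coeffs) : IsProlonged A (reducedSpan A) where
  symm E hE k := by
    refine sub_eq_zero.1 (hE ((LinearMap.proj k).comp (((LinearMap.proj 1).comp
      ((LinearMap.proj 0).comp (tensorAct A))) - ((LinearMap.proj 0).comp
      ((LinearMap.proj 1).comp (tensorAct A))))) fun v hv p hp => ?_)
    simpa using sub_eq_zero.2 (tensorAct_symm hv 0 1 k hp)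
  prolong_mem i E hE φ hφ := by
    refine hE (φ.comp (prolong A i)) fun v hv p hp => ?_
    obtain ⟨D, hD, hDi⟩ := exists_hasFDerivAt_reducedAt (A := A) hv hp
    have hx : p 0 ≠ 0 := ne_of_gt hp
    -- the derivative of the function `φ (reducedAt v)`, which vanishes on the half plane
    have h1 : HasFDerivAt (fun q => φ (reducedAt v q)) _ p :=
      (LinearMap.toContinuousLinearMap φ).hasFDerivAt.comp p hD
    have h2 : HasFDerivAt (fun q => φ (reducedAt v q)) (0 : (Fin 2 → ℝ) →L[ℝ] ℝ) p :=
      (hasFDerivAt_const (0 : ℝ) p).congr_of_eventuallyEq (by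
        filter_upwards [isOpen_halfPlane.mem_nhds hp] with q hq using hφ v hv q hq)
    have h3 := congrArg (fun M => M (Pi.single i 1)) (h1.unique h2)
    simpa [hDi, hx] using h3
  comm E hE := by
    refine sub_eq_zero.1 (eq_zero_of_mem_reducedSpan ((prolong A 1).comp (prolong A 0)
      - (prolong A 0).comp (prolong A 1) - prolong A 1) (fun v hv p hp => ?_) hE)
    simpa using sub_eq_zero.2 (prolong_comm hv hp)

/-! ### Jets and the dimension of the Killing algebra -/

/-- The point `(1, 0)` of the half plane. -/
def basePoint : halfPlane := ⟨![1, 0], by simp [halfPlane]⟩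

/-- The value and the reduced derivative of a Killing field at `(1, 0)`. -/
noncomputable def jet (A : Coeffs) : killing A →ₗ[ℝ] (Fin 2 → ℝ) × Frame where
  toFun v := (v.1 basePoint, reducedAt v basePoint)
  map_add' v w := by
    refine Prod.ext rfl ?_
    funext j k
    have e := pderiv_add j (differentiableAt_of_smooth (v.2.1 k) basePoint.2)
      (differentiableAt_of_smooth (w.2.1 k) basePoint.2)
    simp only [reducedAt, reduced, Submodule.coe_add, component_add, e, Pi.add_apply, Prod.snd_add]
    split_ifs <;> ring
  map_smul' c v := by
    refine Prod.ext rfl ?_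
    funext j k
    simp only [reducedAt, reduced, Submodule.coe_smul, component_smul, pderiv_smul, Pi.smul_apply,
      smul_eq_mul, RingHom.id_apply, Prod.smul_snd]
    split_ifs <;> ring

/-- A field with zero jet has vanishing reduced derivative everywhere, so it is a combination of `X`
and `∂₂`, which is determined by its value at `(1, 0)`. -/
theorem jet_injective (A : Coeffs) : Function.Injective (jet A) := by
  rw [← LinearMap.ker_eq_bot, LinearMap.ker_eq_bot']
  rintro ⟨v, hv⟩ h
  have h1 : v basePoint = 0 := congrArg Prod.fst h
  have h2 : reducedAt v basePoint = 0 := congrArg Prod.snd h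
  obtain ⟨a, b, rfl⟩ := exists_eq_of_reducedAt_eq_zero hv.1
    fun p hp => reducedAt_eq_zero hv basePoint.2 hp h2
  have ha := congrFun h1 0
  have hb := congrFun h1 1
  simp [X, D₂, field, basePoint] at ha hb
  simp [ha, hb]

/-- If `m` linear coordinates separate the elements of `reducedSpan A`, then the space of affine
Killing fields has dimension at most `2 + m`. -/
theorem finrank_killing_le {A : Coeffs} {m : ℕ} (π : Frame →ₗ[ℝ] Fin m → ℝ)
    (hπ : ∀ E ∈ reducedSpan A, π E = 0 → E = 0) :
    FiniteDimensional ℝ (killing A) ∧ Module.finrank ℝ (killing A) ≤ 2 + m := by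
  let f : killing A →ₗ[ℝ] (Fin 2 → ℝ) × (Fin m → ℝ) :=
    (LinearMap.prodMap LinearMap.id π).comp (jet A)
  have hf : Function.Injective f := by
    rw [← LinearMap.ker_eq_bot, LinearMap.ker_eq_bot']
    intro v h
    have h1 : v.1 basePoint = 0 := congrArg Prod.fst h
    have h2 : π (reducedAt v basePoint) = 0 := congrArg Prod.snd h
    have h3 := hπ _ (reducedAt_mem v.2 basePoint.2) h2
    exact jet_injective A ((Prod.ext h1 h3 : jet A v = 0).trans (map_zero _).symm)
  refine ⟨FiniteDimensional.of_injective f hf, ?_⟩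
  simpa using LinearMap.finrank_le_finrank_of_injective hf

/-- A family of `n` affine Killing fields with independent jets at `(1, 0)` is a basis as soon as
the dimension is at most `n`. -/
theorem hasKillingBasis_of_jets {A : Coeffs} {n : ℕ} {b : Fin n → VectorField}
    (hb : ∀ i, b i ∈ killing A) (hfin : FiniteDimensional ℝ (killing A))
    (hn : Module.finrank ℝ (killing A) ≤ n)
    (hli : LinearIndependent ℝ fun i => jet A ⟨b i, hb i⟩) : HasKillingBasis A b := by
  have h1 : LinearIndependent ℝ fun i => (⟨b i, hb i⟩ : killing A) := hli.of_comp (jet A)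
  have h2 : LinearIndependent ℝ b := h1.map' (killing A).subtype (Submodule.ker_subtype _)
  refine ⟨h2, Submodule.eq_of_le_of_finrank_le ?_ ?_⟩
  · rw [Submodule.span_le]
    rintro _ ⟨i, rfl⟩
    exact hb i
  · rw [finrank_span_eq_card h2]
    simpa using hn

/-! ### Vector fields with elementary components -/

/-- Expressions for elementary functions on the half plane, in which all the listed vector fields
can be written. Their derivatives are computed symbolically; `invX`, `logX` and `powX a` stand for
`1 / x¹`, `log x¹` and `(x¹) ^ a`. -/
inductive Elem : Type
  | const (r : ℝ)
  | x
  | y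
  | invX
  | logX
  | powX (a : ℝ)
  | add (f g : Elem)
  | mul (f g : Elem)

namespace Elem

/-- The function denoted by an expression. -/
noncomputable def eval : Elem → ℝ → ℝ → ℝ
  | const r, _, _ => r
  | x, s, _ => s
  | y, _, t => t
  | invX, s, _ => s⁻¹
  | logX, s, _ => Real.log s
  | powX a, s, _ => s ^ a
  | add f g, s, t => f.eval s t + g.eval s t
  | mul f g, s, t => f.eval s t * g.eval s t

/-- The symbolic partial derivative of an expression. -/
noncomputable def diff (i : Fin 2) : Elem → Elem
  | const _ => const 0
  | x => const (if i = 0 then 1 else 0)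
  | y => const (if i = 1 then 1 else 0)
  | invX => mul (const (if i = 0 then -1 else 0)) (mul invX invX)
  | logX => mul (const (if i = 0 then 1 else 0)) invX
  | powX a => mul (const (if i = 0 then a else 0)) (mul invX (powX a))
  | add f g => add (f.diff i) (g.diff i)
  | mul f g => add (mul (f.diff i) g) (mul f (g.diff i))

/-- The function denoted by an expression, on the plane. -/
noncomputable def toFun (f : Elem) : (Fin 2 → ℝ) → ℝ := fun p => f.eval (p 0) (p 1)

theorem contDiffOn_toFun (f : Elem) : ContDiffOn ℝ ∞ f.toFun halfPlane := by
  have h0 : ContDiffOn ℝ ∞ (fun p : Fin 2 → ℝ => p 0) halfPlane := by fun_prop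
  induction f with
  | const r => exact contDiffOn_const
  | x => exact h0
  | y => exact (by fun_prop : ContDiffOn ℝ ∞ (fun p : Fin 2 → ℝ => p 1) halfPlane)
  | invX => exact h0.inv fun p hp => ne_of_gt hp
  | logX => exact h0.log fun p hp => ne_of_gt hp
  | powX a => exact h0.rpow_const_of_ne fun p hp => ne_of_gt hp
  | add f g hf hg => exact hf.add hg
  | mul f g hf hg => exact hf.mul hg

theorem hasFDerivAt_coord (j : Fin 2) (p : Fin 2 → ℝ) : HasFDerivAt (fun q : Fin 2 → ℝ => q j)
    (ContinuousLinearMap.proj (R := ℝ) (φ := fun _ : Fin 2 => ℝ) j) p :=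
  (ContinuousLinearMap.proj (R := ℝ) (φ := fun _ : Fin 2 => ℝ) j).hasFDerivAt

theorem pderiv_comp_fst {g : ℝ → ℝ} {g' : ℝ} (i : Fin 2) {p : Fin 2 → ℝ}
    (hg : HasDerivAt g g' (p 0)) :
    pderiv i (fun q => g (q 0)) p = if i = 0 then g' else 0 := by
  have h : fderiv ℝ (fun q : Fin 2 → ℝ => g (q 0)) p = _ :=
    (hg.comp_hasFDerivAt p (hasFDerivAt_coord 0 p)).fderiv
  rw [pderiv, h]
  fin_cases i <;> simp

theorem pderiv_toFun (f : Elem) (i : Fin 2) {p : Fin 2 → ℝ} (hp : p ∈ halfPlane) :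
    pderiv i f.toFun p = (f.diff i).toFun p := by
  have hx : p 0 ≠ 0 := ne_of_gt hp
  induction f with
  | const r =>
    have : (const r).toFun = fun _ => r := rfl
    simp [pderiv, this, toFun, eval, diff]
  | x =>
    refine (pderiv_comp_fst i (hasDerivAt_id (p 0))).trans ?_
    simp [toFun, eval, diff]
  | y =>
    refine (pderiv_coord i 1 p).trans ?_
    simp [toFun, eval, diff]
  | invX =>
    refine (pderiv_inv_coord i hp).trans ?_
    simp [toFun, eval, diff]
  | logX =>
    refine (pderiv_comp_fst i (Real.hasDerivAt_log hx)).trans ?_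
    simp [toFun, eval, diff]
  | powX a =>
    refine (pderiv_comp_fst i (Real.hasDerivAt_rpow_const (Or.inl hx))).trans ?_
    simp only [toFun, eval, diff]
    rw [Real.rpow_sub_one hx]
    split_ifs <;> ring
  | add f g hf hg =>
    have := pderiv_add i (differentiableAt_of_smooth f.contDiffOn_toFun hp)
      (differentiableAt_of_smooth g.contDiffOn_toFun hp)
    rw [hf, hg] at this
    exact this
  | mul f g hf hg =>
    have := pderiv_mul i (differentiableAt_of_smooth f.contDiffOn_toFun hp)
      (differentiableAt_of_smooth g.contDiffOn_toFun hp)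
    rw [hf, hg] at this
    exact this

/-- The vector field whose components are given by two expressions. -/
noncomputable def vectorField (e : Fin 2 → Elem) : VectorField :=
  fun p k => (e k).toFun p

theorem component_vectorField (e : Fin 2 → Elem) (k : Fin 2) :
    Set.EqOn (component (vectorField e) k) (e k).toFun halfPlane :=
  fun p hp => component_apply (vectorField e) k ⟨p, hp⟩

theorem pderiv_component (e : Fin 2 → Elem) (i k : Fin 2) :
    Set.EqOn (pderiv i (component (vectorField e) k)) ((e k).diff i).toFun halfPlane :=
  fun p hp => by rw [pderiv_congr (component_vectorField e k) i hp, pderiv_toFun _ i hp]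

/-- The left hand side of the affine Killing equations for a field with elementary components. -/
noncomputable def killingLHS (A : Coeffs) (e : Fin 2 → Elem) (i j k : Fin 2) (s t : ℝ) : ℝ :=
  (((e k).diff j).diff i).eval s t - (e 0).eval s t * (A i j k / s ^ 2)
    + ∑ l, (-(A i j l / s) * ((e k).diff l).eval s t + A i l k / s * ((e l).diff j).eval s t
      + A l j k / s * ((e l).diff i).eval s t)

theorem vectorField_mem_killing {A : Coeffs} {e : Fin 2 → Elem}
    (h : ∀ s t, 0 < s → ∀ i j k, killingLHS A e i j k s t = 0) :
    vectorField e ∈ killing A := by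
  refine ⟨fun k => (e k).contDiffOn_toFun.congr (component_vectorField e k),
    fun i j k p hp => ?_⟩
  rw [← h (p 0) (p 1) hp i j k, killingExpr, pderiv_congr (pderiv_component e j k) i hp,
    pderiv_toFun _ i hp]
  simp only [killingLHS, Fin.sum_univ_two, pderiv_christoffel A _ _ _ _ hp, christoffel,
    component_vectorField e _ hp, pderiv_component e _ _ hp, toFun, if_true, one_ne_zero, if_false]
  ring

/-- A family of Killing fields with elementary components whose 1-jets at `(1, 0)` are independent
is a basis if the dimension is at most its length. -/
theorem hasKillingBasis {A : Coeffs} {n m : ℕ} {b : Fin n → VectorField}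
    (e : Fin n → Fin 2 → Elem) (hb : ∀ i, b i = vectorField (e i))
    (hk : ∀ i s t, 0 < s → ∀ j k l, killingLHS A (e i) j k l s t = 0)
    (π : Frame →ₗ[ℝ] Fin m → ℝ) (hπ : ∀ E ∈ reducedSpan A, π E = 0 → E = 0) (hn : 2 + m ≤ n)
    (hli : ∀ c : Fin n → ℝ, (∀ k, ∑ i, c i * (e i k).eval 1 0 = 0) →
      (∀ j k, ∑ i, c i * ((e i k).diff j).eval 1 0 = 0) → c = 0) :
    HasKillingBasis A b := by
  obtain rfl : b = fun i => vectorField (e i) := funext hb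
  obtain ⟨hf, hd⟩ := finrank_killing_le π hπ
  refine hasKillingBasis_of_jets (fun i => vectorField_mem_killing (hk i)) hf (hd.trans hn) ?_
  rw [Fintype.linearIndependent_iff]
  intro c hc
  have h1 : ∀ k, ∑ i, c i * (e i k).eval 1 0 = 0 := fun k => by
    have := congrFun (congrArg Prod.fst hc) k
    simpa [jet, Prod.fst_sum, vectorField, toFun, basePoint] using this
  refine congrFun (hli c h1 fun j k => ?_)
  have h2 := congrFun (congrFun (congrArg Prod.snd hc) j) k
  have hp := basePoint.2
  simp only [jet, LinearMap.coe_mk, AddHom.coe_mk, Prod.snd_sum, Prod.smul_snd, Finset.sum_apply,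
    Pi.smul_apply, smul_eq_mul, reducedAt, reduced, pderiv_component _ _ _ hp,
    component_vectorField _ _ hp, toFun, Prod.snd_zero, Pi.zero_apply, mul_sub,
    Finset.sum_sub_distrib] at h2
  have h3 := h1 0
  split_ifs at h2 <;> simpa [basePoint, h3] using h2

end Elem

/-! ### The prolongation operators in coordinates -/

/-- The Type B model with symmetric part `S₁₁ = (p, q)`, `S₁₂ = (r, s)`, `S₂₂ = (m, n)` and
torsion `(t, u)`. -/
noncomputable def model (p q r s m n t u : ℝ) : Coeffs :=
  typeB p q (r + t) (s + u) (r - t) (s - u) m n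

theorem exists_eq_model (A : Coeffs) : ∃ p q r s m n t u, A = model p q r s m n t u := by
  refine ⟨A 0 0 0, A 0 0 1, (A 0 1 0 + A 1 0 0) / 2, (A 0 1 1 + A 1 0 1) / 2, A 1 1 0, A 1 1 1,
    (A 0 1 0 - A 1 0 0) / 2, (A 0 1 1 - A 1 0 1) / 2, ?_⟩
  funext i j k
  fin_cases i <;> fin_cases j <;> fin_cases k <;> simp [model, typeB] <;> ring

/-- The element of `𝔤𝔩₂` with `E₁ = (a, b)` and `E₂ = (c, d)`. -/
def frameOf (a b c d : ℝ) : Frame := ![![a, b], ![c, d]]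

theorem exists_eq_frameOf (E : Frame) : ∃ a b c d, E = frameOf a b c d := by
  refine ⟨E 0 0, E 0 1, E 1 0, E 1 1, ?_⟩
  funext j k
  fin_cases j <;> fin_cases k <;> rfl

theorem frameOf_inj {a b c d a' b' c' d' : ℝ} :
    frameOf a b c d = frameOf a' b' c' d' ↔ a = a' ∧ b = b' ∧ c = c' ∧ d = d' := by
  constructor
  · intro h
    exact ⟨congrFun (congrFun h 0) 0, congrFun (congrFun h 0) 1, congrFun (congrFun h 1) 0,
      congrFun (congrFun h 1) 1⟩
  · rintro ⟨rfl, rfl, rfl, rfl⟩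
    rfl

theorem frameOf_eq_zero {a b c d : ℝ} :
    frameOf a b c d = 0 ↔ a = 0 ∧ b = 0 ∧ c = 0 ∧ d = 0 := by
  have : (0 : Frame) = frameOf 0 0 0 0 := by
    funext j k
    fin_cases j <;> fin_cases k <;> rfl
  rw [this, frameOf_inj]

theorem frameOf_sub (a b c d a' b' c' d' : ℝ) :
    frameOf a b c d - frameOf a' b' c' d' = frameOf (a - a') (b - b') (c - c') (d - d') := by
  funext j k
  fin_cases j <;> fin_cases k <;> rfl

theorem smul_frameOf (x a b c d : ℝ) :
    x • frameOf a b c d = frameOf (x * a) (x * b) (x * c) (x * d) := by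
  funext j k
  fin_cases j <;> fin_cases k <;> rfl

namespace IsProlonged

variable {K : Submodule ℝ Frame} {p q r s m n t u a b c d : ℝ}

theorem torsion (h : IsProlonged (model p q r s m n t u) K) (hE : frameOf a b c d ∈ K) :
    u * c = t * d ∧ t * b = u * a := by
  have h0 := h.symm _ hE 0
  have h1 := h.symm _ hE 1
  simp [tensorAct_apply, model, typeB, frameOf, Fin.sum_univ_two] at h0 h1
  constructor <;> linarith

theorem prolong_zero (h : IsProlonged (model p q r s m n t u) K) (hE : frameOf a b c d ∈ K) :
    prolong (model p q r s m n t u) 0 (frameOf a b c d) = frameOf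
      (-(p + 1) * a + q * c - 2 * r * b) ((p - 2 * s) * b + q * d - 2 * q * a)
      ((s - p) * c - r * d - m * b) ((r - n) * b - q * c - (s + 1) * a) := by
  obtain ⟨h0, h1⟩ := h.torsion hE
  funext j k
  fin_cases j <;> fin_cases k <;>
    simp [prolong_apply, tensorAct_apply, model, typeB, frameOf, Fin.sum_univ_two] <;> linarith

theorem prolong_one (h : IsProlonged (model p q r s m n t u) K) (hE : frameOf a b c d ∈ K) :
    prolong (model p q r s m n t u) 1 (frameOf a b c d) = frameOf
      ((s - p - 1) * c - r * d - m * b) ((r - n) * b - q * c - s * a)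
      (m * a + (n - 2 * r) * c - 2 * m * d) (m * b - n * d - (2 * s + 1) * c) := by
  obtain ⟨h0, h1⟩ := h.torsion hE
  funext j k
  fin_cases j <;> fin_cases k <;>
    simp [prolong_apply, tensorAct_apply, model, typeB, frameOf, Fin.sum_univ_two] <;> linarith

theorem mem_zero (h : IsProlonged (model p q r s m n t u) K) (hE : frameOf a b c d ∈ K) :
    frameOf (-(p + 1) * a + q * c - 2 * r * b) ((p - 2 * s) * b + q * d - 2 * q * a)
      ((s - p) * c - r * d - m * b) ((r - n) * b - q * c - (s + 1) * a) ∈ K := by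
  rw [← h.prolong_zero hE]
  exact h.prolong_mem 0 _ hE

theorem mem_one (h : IsProlonged (model p q r s m n t u) K) (hE : frameOf a b c d ∈ K) :
    frameOf ((s - p - 1) * c - r * d - m * b) ((r - n) * b - q * c - s * a)
      (m * a + (n - 2 * r) * c - 2 * m * d) (m * b - n * d - (2 * s + 1) * c) ∈ K := by
  rw [← h.prolong_one hE]
  exact h.prolong_mem 1 _ hE

/-- The integrability conditions, in coordinates. -/
theorem integrability (h : IsProlonged (model p q r s m n t u) K) (hE : frameOf a b c d ∈ K) :
    ∃ a₁ b₁ c₁ d₁ a₂ b₂ c₂ d₂ : ℝ,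
      (a₁ = -(p + 1) * a + q * c - 2 * r * b ∧ b₁ = (p - 2 * s) * b + q * d - 2 * q * a ∧
        c₁ = (s - p) * c - r * d - m * b ∧ d₁ = (r - n) * b - q * c - (s + 1) * a) ∧
      (a₂ = (s - p - 1) * c - r * d - m * b ∧ b₂ = (r - n) * b - q * c - s * a ∧
        c₂ = m * a + (n - 2 * r) * c - 2 * m * d ∧ d₂ = m * b - n * d - (2 * s + 1) * c) ∧
      ((s - p - 1) * c₁ - r * d₁ - m * b₁ - (-(p + 1) * a₂ + q * c₂ - 2 * r * b₂) = a₂ ∧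
        (r - n) * b₁ - q * c₁ - s * a₁ - ((p - 2 * s) * b₂ + q * d₂ - 2 * q * a₂) = b₂ ∧
        m * a₁ + (n - 2 * r) * c₁ - 2 * m * d₁ - ((s - p) * c₂ - r * d₂ - m * b₂) = c₂ ∧
        m * b₁ - n * d₁ - (2 * s + 1) * c₁ - ((r - n) * b₂ - q * c₂ - (s + 1) * a₂) = d₂) := by
  refine ⟨_, _, _, _, _, _, _, _, ⟨rfl, rfl, rfl, rfl⟩, ⟨rfl, rfl, rfl, rfl⟩, ?_⟩
  have e := h.comm _ hE
  rwa [h.prolong_zero hE, h.prolong_one hE, h.prolong_one (h.mem_zero hE),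
    h.prolong_zero (h.mem_one hE), frameOf_sub, frameOf_inj] at e

end IsProlonged

/-! ### A common kernel -/

/-- If `g f - f g = g` on a nonzero finite-dimensional space, then `g` is not injective: otherwise
`g f g⁻¹ - f` would be the identity, which has nonzero trace. -/
theorem exists_ker_of_comm {V : Type*} [AddCommGroup V] [Module ℝ V] [FiniteDimensional ℝ V]
    [Nontrivial V] (f g : V →ₗ[ℝ] V) (h : g ∘ₗ f - f ∘ₗ g = g) : ∃ x, x ≠ 0 ∧ g x = 0 := by
  by_contra! hc
  have hinj : Function.Injective g := by
    rw [← LinearMap.ker_eq_bot, LinearMap.ker_eq_bot']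
    intro x hx
    by_contra h0
    exact hc x h0 hx
  let e := LinearEquiv.ofInjectiveEndo g hinj
  have he : ∀ x, e x = g x := fun x => rfl
  have h1 : e.conj f - f = LinearMap.id := by
    ext x
    obtain ⟨y, rfl⟩ := e.surjective x
    have := congrArg (fun L => L y) h
    have hy : e.symm (g y) = y := e.symm_apply_apply y
    simpa [LinearEquiv.conj_apply, he, hy] using this
  have h2 := congrArg (LinearMap.trace ℝ V) h1
  rw [map_sub, LinearMap.trace_conj', sub_self, LinearMap.trace_id] at h2
  exact Module.finrank_pos.ne' (by exact_mod_cast h2.symm : Module.finrank ℝ V = 0)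

theorem IsProlonged.exists_prolong_one_eq_zero {A : Coeffs} {K : Submodule ℝ Frame}
    (h : IsProlonged A K) (hK : K ≠ ⊥) : ∃ E ∈ K, E ≠ 0 ∧ prolong A 1 E = 0 := by
  have : Nontrivial K := Submodule.nontrivial_iff_ne_bot.2 hK
  obtain ⟨x, hx, hx'⟩ := exists_ker_of_comm
    ((prolong A 0).restrict (h.prolong_mem 0)) ((prolong A 1).restrict (h.prolong_mem 1)) (by
      ext1 x
      exact Subtype.ext (h.comm x.1 x.2))
  exact ⟨x, x.2, fun h0 => hx (Subtype.ext h0), congrArg Subtype.val hx'⟩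

/-! ### Shears -/

/-- The effect of the shear `(x¹, x²) ↦ (x¹, a (x² + β x¹))` on the coefficients. -/
theorem shearAct_model {a : ℝ} (ha : a ≠ 0) (β p q r s m n t u : ℝ) :
    shearAct a (a * β) (model p q r s m n t u) = model (p - 2 * β * r + β ^ 2 * m)
      (a * (q - 2 * β * s + β ^ 2 * n + β * (p - 2 * β * r + β ^ 2 * m)))
      ((r - β * m) / a) (s - β * n + β * (r - β * m)) (m / a ^ 2) ((n + β * m) / a)
      (t / a) (u + β * t) := by
  have hinv : (shear a (a * β))⁻¹ = !![1, 0; -β, 1 / a] := by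
    apply Matrix.inv_eq_right_inv
    ext i j
    fin_cases i <;> fin_cases j <;> simp [shear, Matrix.mul_apply, Fin.sum_univ_two, ha]
  funext i j k
  fin_cases i <;> fin_cases j <;> fin_cases k <;>
    simp only [shearAct, hinv] <;> simp [shear, Fin.sum_univ_two, model, typeB] <;>
    field_simp <;> ring

/-- The model is linearly equivalent to one of the listed models. -/
def IsClassified (A : Coeffs) : Prop := ∃ B, IsListed B ∧ LinearlyEquivalent A B

theorem isClassified_model {p q r s m n t u : ℝ} (β a : ℝ) (ha : a ≠ 0)
    {p' q' r' s' m' n' t' u' : ℝ} (hp : p - 2 * β * r + β ^ 2 * m = p')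
    (hq : a * (q - 2 * β * s + β ^ 2 * n + β * (p - 2 * β * r + β ^ 2 * m)) = q')
    (hr : (r - β * m) / a = r') (hs : s - β * n + β * (r - β * m) = s') (hm : m / a ^ 2 = m')
    (hn : (n + β * m) / a = n') (ht : t / a = t') (hu : u + β * t = u')
    (h : IsListed (model p' q' r' s' m' n' t' u')) : IsClassified (model p q r s m n t u) := by
  subst hp hq hr hs hm hn ht hu
  exact ⟨_, h, a, a * β, ha, shearAct_model ha β p q r s m n t u⟩

theorem model_eq {p q r s m n t u a b c d e f g h : ℝ} (h1 : p = a) (h2 : q = b) (h3 : r + t = c)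
    (h4 : s + u = d) (h5 : r - t = e) (h6 : s - u = f) (h7 : m = g) (h8 : n = h) :
    model p q r s m n t u = typeB a b c d e f g h := by
  subst h1 h2 h3 h4 h5 h6 h7 h8
  rfl

/-- The models with `S₁₂¹ = 0`, `S₂₂ = 0` and `T¹ = 0` are all classified. A shear adds
`β (p - 2 s)` to `q`, so that `q` can be removed unless `p = 2 s`, when it can be scaled to `1`. -/
theorem isClassified_of_fibred (p q s u : ℝ) : IsClassified (model p q 0 s 0 0 0 u) := by
  by_cases hps : p = 2 * s
  · by_cases hq : q = 0
    · subst hq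
      by_cases hs : s = 0
      · refine isClassified_model 0 1 one_ne_zero rfl rfl rfl rfl rfl rfl rfl rfl
          (Or.inl ⟨u, ?_⟩)
        exact model_eq (by linarith) (by ring) (by ring) (by linarith) (by ring) (by linarith)
          (by ring) (by ring)
      by_cases hs1 : s = -1
      · refine isClassified_model 0 1 one_ne_zero rfl rfl rfl rfl rfl rfl rfl rfl
          (Or.inr <| Or.inr <| Or.inl ⟨-1, u, by norm_num, ?_⟩)
        exact model_eq (by linarith) (by ring) (by ring) (by linarith) (by ring) (by linarith)
          (by ring) (by ring)
      · refine isClassified_model 0 1 one_ne_zero rfl rfl rfl rfl rfl rfl rfl rfl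
          (Or.inr <| Or.inr <| Or.inr <| Or.inr <| Or.inr <| Or.inr <| Or.inr <| Or.inr <|
            Or.inr <| Or.inl ⟨s, 1, u, by norm_num, mul_ne_zero hs fun h => hs1 (by linarith), ?_⟩)
        exact model_eq (by linarith) (by ring) (by ring) (by linarith) (by ring) (by linarith)
          (by ring) (by ring)
    · have hq' : q⁻¹ ≠ 0 := inv_ne_zero hq
      have e : q⁻¹ * q = 1 := inv_mul_cancel₀ hq
      by_cases hs : s = 0
      · refine isClassified_model 0 q⁻¹ hq' rfl rfl rfl rfl rfl rfl rfl rfl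
          (Or.inr <| Or.inr <| Or.inr <| Or.inr <| Or.inr <| Or.inl ⟨u, ?_⟩)
        exact model_eq (by linarith) (by linarith) (by ring) (by linarith) (by ring) (by linarith)
          (by ring) (by ring)
      by_cases hs1 : s = -1
      · refine isClassified_model 0 q⁻¹ hq' rfl rfl rfl rfl rfl rfl rfl rfl
          (Or.inr <| Or.inr <| Or.inr <| Or.inr <| Or.inl ⟨u, ?_⟩)
        exact model_eq (by linarith) (by linarith) (by ring) (by linarith) (by ring) (by linarith)
          (by ring) (by ring)
      · refine isClassified_model 0 q⁻¹ hq' rfl rfl rfl rfl rfl rfl rfl rfl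
          (Or.inr <| Or.inr <| Or.inr <| Or.inr <| Or.inr <| Or.inr <| Or.inr <| Or.inr <|
            Or.inl ⟨s, u, hs, hs1, ?_⟩)
        exact model_eq (by linarith) (by linarith) (by ring) (by linarith) (by ring) (by linarith)
          (by ring) (by ring)
  · have h0 : p - 2 * s ≠ 0 := sub_ne_zero.2 hps
    have key : IsListed (model p 0 0 s 0 0 0 u) → IsClassified (model p q 0 s 0 0 0 u) :=
      isClassified_model (-q / (p - 2 * s)) 1 one_ne_zero (by ring)
        (by field_simp; ring) (by ring) (by ring) (by ring) (by ring) (by ring) (by ring)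
    refine key ?_
    by_cases hs : s = 0
    · subst hs
      by_cases hp : p = -1
      · exact Or.inr <| Or.inr <| Or.inr <| Or.inr <| Or.inr <| Or.inr <| Or.inl ⟨u,
          model_eq hp rfl (by ring) (by ring) (by ring) (by ring) rfl rfl⟩
      · exact Or.inr <| Or.inr <| Or.inr <| Or.inr <| Or.inr <| Or.inr <| Or.inr <| Or.inl ⟨p, u,
          by simpa using h0, hp, model_eq rfl rfl (by ring) (by ring) (by ring) (by ring) rfl rfl⟩
    by_cases h1 : p = s - 1
    · exact Or.inr <| Or.inr <| Or.inl ⟨s, u, hs,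
        model_eq (by linarith) rfl (by ring) (by ring) (by ring) (by ring) rfl rfl⟩
    by_cases h2 : p = 2 * s - 1
    · exact Or.inr <| Or.inr <| Or.inr <| Or.inr <| Or.inr <| Or.inr <| Or.inr <| Or.inr <|
        Or.inr <| Or.inr <| Or.inl ⟨s, u, hs,
        model_eq (by linarith) rfl (by ring) (by ring) (by ring) (by ring) rfl rfl⟩
    · refine Or.inr <| Or.inr <| Or.inr <| Or.inr <| Or.inr <| Or.inr <| Or.inr <| Or.inr <|
        Or.inr <| Or.inl ⟨s, 1 + p - 2 * s, u, ?_, mul_ne_zero hs ?_,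
        model_eq (by ring) rfl (by ring) (by ring) (by ring) (by ring) rfl rfl⟩
      · exact fun h => h2 (by linarith)
      · exact fun h => h1 (by linarith)

/-! ### The classification -/

namespace IsProlonged

variable {K : Submodule ℝ Frame} {p q r s m n t u : ℝ}

/-- With torsion `T¹ ≠ 0`, all elements have the form `((a, τ a), (c, τ c))`, `τ = T² / T¹`, and
this is stable under prolongation in one case only. -/
theorem params_of_fibred (h : IsProlonged (model p q 0 s 0 0 t u) K) (ht : t ≠ 0) (hK : K ≠ ⊥) :
    s = -(1 / 2) ∧ p = -(3 / 2) ∧ 2 * q * t = -u := by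
  obtain ⟨E, hE, hE0⟩ := Submodule.exists_mem_ne_zero_of_ne_bot hK
  obtain ⟨a, b, c, d, rfl⟩ := exists_eq_frameOf E
  obtain ⟨τ, rfl⟩ : ∃ τ, u = t * τ := ⟨u / t, by field_simp⟩
  have tor : ∀ {a b c d}, frameOf a b c d ∈ K → d = τ * c ∧ b = τ * a := fun hE => by
    obtain ⟨h1, h2⟩ := h.torsion hE
    exact ⟨mul_left_cancel₀ ht (by linarith), mul_left_cancel₀ ht (by linarith)⟩
  obtain ⟨hd, hb⟩ := tor hE
  obtain ⟨h1, h2⟩ := tor (h.mem_zero hE)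
  obtain ⟨h3, h4⟩ := tor (h.mem_one hE)
  obtain ⟨h5, -⟩ := tor (h.mem_zero (h.mem_one hE))
  obtain ⟨h6, -⟩ := tor (h.mem_one (h.mem_zero hE))
  have ha : a = -(τ * c) := by linarith
  have hc : c ≠ 0 := by
    rintro rfl
    exact hE0 (frameOf_eq_zero.2 ⟨by simp [ha], by simp [hb, ha], rfl, by simp [hd]⟩)
  have hs : s = -(1 / 2) := by
    have : (2 * s + 1) * c = 0 := by linarith
    have := (mul_eq_zero.1 this).resolve_right hc
    linarith
  subst hs
  have ha2 : ((-(1 / 2) : ℝ) - p - 1) * c = 0 := by linarith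
  have hp : p = -(3 / 2) := by
    have := (mul_eq_zero.1 ha2).resolve_right hc
    linarith
  subst hp
  refine ⟨rfl, rfl, mul_right_cancel₀ hc ?_⟩
  subst ha
  linear_combination (-2 * t) * h4

theorem isClassified_of_fibred (h : IsProlonged (model p q 0 s 0 0 t u) K) (hK : K ≠ ⊥) :
    IsClassified (model p q 0 s 0 0 t u) := by
  by_cases ht : t = 0
  · subst ht
    exact _root_.isClassified_of_fibred p q s u
  obtain ⟨hs, hp, hq⟩ := h.params_of_fibred ht hK
  refine isClassified_model (-u / t) 1 one_ne_zero rfl rfl rfl rfl rfl rfl rfl rfl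
    (Or.inr <| Or.inr <| Or.inr <| Or.inl ⟨t, ht, ?_⟩)
  subst hs hp
  have e : q = -u / t / 2 := by field_simp; linarith
  refine model_eq (by ring) (by rw [e]; ring) (by ring) ?_ (by ring) ?_ (by ring) (by ring) <;>
    field_simp <;> ring

/-- The kernel of the second prolongation operator, intersected with `c = 0`, is stable under the
first one. -/
theorem kernel_step (h : IsProlonged (model p q r s m n t u) K) {a b d : ℝ}
    (hE : frameOf a b 0 d ∈ K)
    (h0 : prolong (model p q r s m n t u) 1 (frameOf a b 0 d) = 0) :
    (r * d = -(m * b) ∧ (r - n) * b = s * a ∧ m * a = 2 * m * d ∧ m * b = n * d) ∧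
    frameOf (-(p + 1) * a - 2 * r * b) ((p - 2 * s) * b + q * d - 2 * q * a) 0 (-a) ∈ K ∧
    prolong (model p q r s m n t u) 1
      (frameOf (-(p + 1) * a - 2 * r * b) ((p - 2 * s) * b + q * d - 2 * q * a) 0 (-a)) = 0 := by
  have e := h0
  rw [h.prolong_one hE, frameOf_eq_zero] at e
  obtain ⟨e1, e2, e3, e4⟩ := e
  have e5 : prolong (model p q r s m n t u) 0 (frameOf a b 0 d) = frameOf
      (-(p + 1) * a - 2 * r * b) ((p - 2 * s) * b + q * d - 2 * q * a) 0 (-a) := by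
    rw [h.prolong_zero hE, frameOf_inj]
    refine ⟨by ring, by ring, by linarith, by linarith⟩
  refine ⟨⟨by linarith, by linarith, by linarith, by linarith⟩, ?_, ?_⟩
  · rw [← e5]
    exact h.prolong_mem 0 _ hE
  · have := h.comm _ hE
    rw [h0, map_zero, sub_zero] at this
    rw [← e5, this]

/-- The case of a Killing field `v`, not a combination of `X` and `∂₂`, for which `∂₂ v` is a
multiple of `∂₂`. -/
theorem isClassified_of_kernel (h : IsProlonged (model p q r s m n t u) K) {a b d : ℝ}
    (hE : frameOf a b 0 d ∈ K) (hne : frameOf a b 0 d ≠ 0)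
    (h0 : prolong (model p q r s m n t u) 1 (frameOf a b 0 d) = 0) :
    IsClassified (model p q r s m n t u) := by
  have hK : K ≠ ⊥ := fun hK => hne (by simpa [hK] using hE)
  obtain ⟨⟨e1, e2, e3, e4⟩, hE1, h1⟩ := h.kernel_step hE h0
  obtain ⟨⟨f1, f2, f3, f4⟩, hE2, h2⟩ := h.kernel_step hE1 h1
  obtain ⟨⟨g1, g2, g3, g4⟩, -, -⟩ := h.kernel_step hE2 h2
  by_cases hm : m = 0
  · subst hm
    have hrn : r = 0 ∧ n = 0 := by
      by_cases hd : d = 0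
      · subst hd
        by_cases ha : a = 0
        · subst ha
          have hb : b ≠ 0 := by
            rintro rfl
            exact hne (frameOf_eq_zero.2 ⟨rfl, rfl, rfl, rfl⟩)
          have hrn : r - n = 0 := by simpa [hb] using e2
          have hr : r = 0 := by simpa [hb] using g1
          exact ⟨hr, by linarith⟩
        · exact ⟨by simpa [ha] using f1, by simpa [ha] using f4.symm⟩
      · exact ⟨by simpa [hd] using e1, by simpa [hd] using e4.symm⟩
    obtain ⟨rfl, rfl⟩ := hrn
    exact h.isClassified_of_fibred hK
  -- the shear with parameter `ρ = r / m` removes `r`, and with it `q`, `s` and `n`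
  · obtain ⟨ρ, rfl⟩ : ∃ ρ, r = ρ * m := ⟨r / m, by field_simp⟩
    have ha : a = 2 * d := mul_left_cancel₀ hm (by linarith)
    have hb : b = -(ρ * d) := mul_left_cancel₀ hm (by linarith)
    subst ha hb
    have hd : d ≠ 0 := by
      rintro rfl
      exact hne (frameOf_eq_zero.2 ⟨by simp, by simp, rfl, rfl⟩)
    have hn : n = -(ρ * m) := mul_right_cancel₀ hd (by linarith)
    subst hn
    have hs : s = -(ρ ^ 2 * m) := mul_right_cancel₀ hd (by linarith)
    subst hs
    have hp : p = 1 + ρ ^ 2 * m :=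
      mul_left_cancel₀ (mul_ne_zero hm hd) (by linear_combination -(1 / 2) * f3)
    subst hp
    have hq : q = -(ρ * (1 + ρ ^ 2 * m)) :=
      mul_left_cancel₀ (mul_ne_zero hm hd) (by linear_combination -(1 / 3) * f1)
    subst hq
    obtain ⟨t1, t2⟩ := h.torsion hE
    have ht : t = 0 := by simpa [hd] using t1.symm
    subst ht
    have hu : u = 0 := by simpa [hd] using t2.symm
    subst hu
    have hpos : 0 < |m| := abs_pos.2 hm
    have hsq : Real.sqrt |m| ^ 2 = |m| := Real.sq_sqrt hpos.le
    refine isClassified_model ρ (Real.sqrt |m|) (Real.sqrt_pos.2 hpos).ne' (p' := 1) (q' := 0)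
      (r' := 0) (s' := 0) (m' := m / |m|) (n' := 0) (t' := 0) (u' := 0) (by ring) (by ring)
      (by ring) (by ring) (by rw [hsq]) (by ring) (by ring) (by ring)
      (Or.inr <| Or.inl ⟨m / |m|, ?_, model_eq rfl rfl (by ring) (by ring) (by ring) (by ring)
        rfl rfl⟩)
    rcases abs_cases m with ⟨hm', _⟩ | ⟨hm', _⟩ <;> rw [hm']
    · exact Or.inl (div_self hm)
    · exact Or.inr (by rw [div_neg, div_self hm])

end IsProlonged

/-- The models with a Killing field `v` for which `∂₂ v` is `X` up to a multiple of `∂₂`, after a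
shear which makes the reduced derivative of `v` trace-free of the form `((0, b), (1, 0))`. -/
theorem isListed_of_normal {p r s m n t b : ℝ} (hrb : r * b = 0) (hn : n = 2 * r)
    (hmb : m * b = 2 * s + 1) (hp : p = -s - 2) (hsb : (s + 1) * b = 0) (htb : t * b = 0) :
    ∃ a, a ≠ 0 ∧ IsListed (model p 0 (r / a) s (m / a ^ 2) (n / a) (t / a) 0) := by
  subst hn hp
  by_cases hb : b = 0
  · subst hb
    obtain rfl : s = -(1 / 2) := by linarith
    by_cases hr : r = 0
    · subst hr
      by_cases hm : m = 0
      · subst hm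
        refine ⟨1, one_ne_zero, ?_⟩
        by_cases ht : t = 0
        · exact Or.inr <| Or.inr <| Or.inl ⟨-(1 / 2), 0, by norm_num, model_eq (by ring) rfl
            (by simp [ht]) (by ring) (by simp [ht]) (by ring) (by ring) (by ring)⟩
        · exact Or.inr <| Or.inr <| Or.inr <| Or.inl ⟨t, ht, model_eq (by ring) rfl
            (by ring) (by ring) (by ring) (by ring) (by ring) (by ring)⟩
      · have hpos : 0 < 2 * |m| := by have := abs_pos.2 hm; linarith
        have hsq : Real.sqrt (2 * |m|) ^ 2 = 2 * |m| := Real.sq_sqrt hpos.le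
        refine ⟨Real.sqrt (2 * |m|), (Real.sqrt_pos.2 hpos).ne', ?_⟩
        iterate 11 apply Or.inr
        refine Or.inl ⟨m / |m|, t / Real.sqrt (2 * |m|), ?_, model_eq (by ring) rfl
            (by ring) (by ring) (by ring) (by ring) (by rw [hsq]; field_simp) (by ring)⟩
        rcases abs_cases m with ⟨hm', _⟩ | ⟨hm', _⟩ <;> rw [hm']
        · exact Or.inl (div_self hm)
        · exact Or.inr (by rw [div_neg, div_self hm])
    · refine ⟨r, hr, ?_⟩
      iterate 12 apply Or.inr
      refine Or.inl ⟨m / r ^ 2, t / r, model_eq (by ring) rfl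
            (by rw [div_self hr]) (by ring) (by rw [div_self hr]) (by ring) rfl (by field_simp)⟩
  · obtain rfl : r = 0 := (mul_eq_zero.1 hrb).resolve_right hb
    obtain rfl : t = 0 := (mul_eq_zero.1 htb).resolve_right hb
    obtain rfl : s = -1 := by
      have := (mul_eq_zero.1 hsb).resolve_right hb
      linarith
    have hm : m ≠ 0 := by
      rintro rfl
      norm_num at hmb
    have hpos : 0 < |m| := abs_pos.2 hm
    have hsq : Real.sqrt |m| ^ 2 = |m| := Real.sq_sqrt hpos.le
    refine ⟨Real.sqrt |m|, (Real.sqrt_pos.2 hpos).ne', ?_⟩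
    rw [hsq]
    iterate 13 apply Or.inr
    rcases abs_cases m with ⟨hm', _⟩ | ⟨hm', _⟩ <;> rw [hm']
    · exact Or.inr (model_eq (by ring) rfl (by ring) (by ring) (by ring) (by ring)
        (div_self hm) (by ring))
    · exact Or.inl (model_eq (by ring) rfl (by ring) (by ring) (by ring) (by ring)
        (by rw [div_neg, div_self hm]) (by ring))

/-- The algebraic form of the classification: a model for which some nonzero subspace of `𝔤𝔩₂` is
stable under prolongation is classified. -/
theorem IsProlonged.isClassified {A : Coeffs} {K : Submodule ℝ Frame} (h : IsProlonged A K)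
    (hK : K ≠ ⊥) : IsClassified A := by
  obtain ⟨p, q, r, s, m, n, t, u, rfl⟩ := exists_eq_model A
  obtain ⟨E, hE, hne, h0⟩ := h.exists_prolong_one_eq_zero hK
  obtain ⟨a, b, c, d, rfl⟩ := exists_eq_frameOf E
  by_cases hc : c = 0
  · subst hc
    exact h.isClassified_of_kernel hE hne h0
  -- normalize to `c = 1`
  obtain ⟨a, b, d, hE, h0⟩ : ∃ a b d, frameOf a b 1 d ∈ K ∧
      prolong (model p q r s m n t u) 1 (frameOf a b 1 d) = 0 := by
    refine ⟨c⁻¹ * a, c⁻¹ * b, c⁻¹ * d, ?_⟩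
    have e : frameOf (c⁻¹ * a) (c⁻¹ * b) 1 (c⁻¹ * d) = c⁻¹ • frameOf a b c d := by
      rw [smul_frameOf, inv_mul_cancel₀ hc]
    rw [e, map_smul, h0, smul_zero]
    exact ⟨K.smul_mem _ hE, rfl⟩
  have e0 := h0
  rw [h.prolong_one hE, frameOf_eq_zero] at e0
  obtain ⟨h5, h6, h7, h8⟩ := e0
  -- the difference of the first prolongation and the element itself lies in the kernel
  have hF := K.sub_mem (h.prolong_mem 0 _ hE) hE
  have hF0 : prolong (model p q r s m n t u) 1
      (prolong (model p q r s m n t u) 0 (frameOf a b 1 d) - frameOf a b 1 d) = 0 := by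
    have := h.comm _ hE
    rw [h0, map_zero, sub_zero] at this
    rw [map_sub, this, h0, sub_zero]
  rw [h.prolong_zero hE, frameOf_sub] at hF hF0
  have hF3 : (s - p) * 1 - r * d - m * b - 1 = 0 := by linarith
  rw [hF3] at hF hF0
  by_cases hF1 : frameOf (-(p + 1) * a + q * 1 - 2 * r * b - a)
      ((p - 2 * s) * b + q * d - 2 * q * a - b) 0 ((r - n) * b - q * 1 - (s + 1) * a - d) = 0
  swap
  · exact h.isClassified_of_kernel hF hF1 hF0
  obtain ⟨h1, h2, -, h4⟩ := frameOf_eq_zero.1 hF1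
  obtain ⟨t1, t2⟩ := h.torsion hE
  obtain rfl : d = -a := by linarith
  obtain rfl : u = -(t * a) := by linarith
  -- The shear with parameter `a` turns the element into `((0, b + a²), (1, 0))`; the following are
  -- the equations of the sheared element.
  have k5 : (s - a * n + a * (r - a * m)) - (p - 2 * a * r + a ^ 2 * m) - 1
      - m * (b + a ^ 2) = 0 := by
    linear_combination h5 - a * h7
  have k8 : m * (b + a ^ 2) = 2 * (s - a * n + a * (r - a * m)) + 1 := by
    linear_combination h8 + a * h7
  have k7 : n + a * m = 2 * (r - a * m) := by linear_combination h7
  have k6 : -((r - a * m) * (b + a ^ 2))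
      = q - 2 * a * s + a ^ 2 * n + a * (p - 2 * a * r + a ^ 2 * m) := by
    linear_combination h6 - a * h8 + a * h5 - a ^ 2 * h7 + (b + a ^ 2) * k7
  have k1 : q - 2 * a * s + a ^ 2 * n + a * (p - 2 * a * r + a ^ 2 * m)
      - 2 * ((r - a * m) * (b + a ^ 2)) = 0 := by
    linear_combination h1 - a * hF3 - a * k5
  have k2 : ((p - 2 * a * r + a ^ 2 * m) - 2 * (s - a * n + a * (r - a * m)) - 1)
      * (b + a ^ 2) = 0 := by
    linear_combination h2 - a * h4 + a * h1 - a ^ 2 * hF3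
      - a * (h6 - a * h8 + a * h5 - a ^ 2 * h7)
  obtain ⟨x, hx, hl⟩ := isListed_of_normal (p := p - 2 * a * r + a ^ 2 * m) (r := r - a * m)
    (s := s - a * n + a * (r - a * m)) (m := m) (n := n + a * m) (t := t) (b := b + a ^ 2)
    (by linarith) k7 k8 (by linarith)
    (by linear_combination -(1 / 3) * k2 - (1 / 3) * (b + a ^ 2) * (k5 + k8))
    (by linear_combination t2)
  refine isClassified_model a x hx rfl ?_ rfl rfl rfl rfl rfl (by ring) hl
  rw [show q - 2 * a * s + a ^ 2 * n + a * (p - 2 * a * r + a ^ 2 * m) = 0 by linarith, mul_zero]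

/-! ### Criteria for bases by the bound on the dimension -/

theorem field_eq_vectorField {F : ℝ → ℝ → ℝ × ℝ} {e : Fin 2 → Elem}
    (h : ∀ s t, 0 < s → F s t = ((e 0).eval s t, (e 1).eval s t)) :
    field F = Elem.vectorField e := by
  funext p k
  have := h (p.1 0) (p.1 1) p.2
  fin_cases k <;> simp [field, Elem.vectorField, Elem.toFun, this]

/-- The field `v` is an affine Killing field of the model with coefficients `A`, and `e` gives its
components. -/
structure IsKillingElem (A : Coeffs) (v : VectorField) (e : Fin 2 → Elem) : Prop where
  eq : v = Elem.vectorField e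
  killing : ∀ x y, 0 < x → ∀ i j k, Elem.killingLHS A e i j k x y = 0

/-- The components of `X`. -/
def xElem : Fin 2 → Elem := ![.x, .y]

/-- The components of `∂₂`. -/
def dElem : Fin 2 → Elem := ![.const 0, .const 1]

theorem isKillingElem_X (A : Coeffs) : IsKillingElem A X xElem where
  eq := field_eq_vectorField fun _ _ _ => rfl
  killing x y hx i j k := by
    fin_cases i <;> fin_cases j <;> fin_cases k <;>
      simp [Elem.killingLHS, xElem, Elem.diff, Elem.eval, Fin.sum_univ_two] <;> field_simp <;> ring

theorem isKillingElem_D₂ (A : Coeffs) : IsKillingElem A D₂ dElem where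
  eq := field_eq_vectorField fun _ _ _ => rfl
  killing x y hx i j k := by
    fin_cases i <;> fin_cases j <;> fin_cases k <;>
      simp [Elem.killingLHS, dElem, Elem.diff, Elem.eval]

/-- If every reduced derivative vanishes, the Killing algebra is the minimal one. -/
theorem hasKillingBasis_of_eq_bot {A : Coeffs} (h : reducedSpan A = ⊥) :
    HasKillingBasis A ![X, D₂] := by
  refine Elem.hasKillingBasis (m := 0) ![xElem, dElem] ?_ ?_ 0
    (fun E hE _ => by simpa [h] using hE) le_rfl ?_
  · intro i
    fin_cases i
    exacts [(isKillingElem_X A).eq, (isKillingElem_D₂ A).eq]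
  · intro i
    fin_cases i
    exacts [(isKillingElem_X A).killing, (isKillingElem_D₂ A).killing]
  · intro c h1 _
    have e0 := h1 0
    have e1 := h1 1
    simp [Fin.sum_univ_succ, xElem, dElem, Elem.eval] at e0 e1
    funext i
    fin_cases i
    exacts [e0, e1]

/-- The entry `E_j^k`, as a linear functional. -/
def entry (j k : Fin 2) : Frame →ₗ[ℝ] ℝ where
  toFun E := E j k
  map_add' _ _ := rfl
  map_smul' _ _ := rfl

theorem hasKillingBasis_six {A : Coeffs} {v₀ v₁ v₂ v₃ v₄ v₅ : VectorField}
    {e₀ e₁ e₂ e₃ e₄ e₅ : Fin 2 → Elem} (h₀ : IsKillingElem A v₀ e₀) (h₁ : IsKillingElem A v₁ e₁)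
    (h₂ : IsKillingElem A v₂ e₂) (h₃ : IsKillingElem A v₃ e₃) (h₄ : IsKillingElem A v₄ e₄)
    (h₅ : IsKillingElem A v₅ e₅)
    (hli : ∀ c : Fin 6 → ℝ, (∀ k, ∑ i, c i * (![e₀, e₁, e₂, e₃, e₄, e₅] i k).eval 1 0 = 0) →
      (∀ j k, ∑ i, c i * ((![e₀, e₁, e₂, e₃, e₄, e₅] i k).diff j).eval 1 0 = 0) →
      c 0 = 0 ∧ c 1 = 0 ∧ c 2 = 0 ∧ c 3 = 0 ∧ c 4 = 0 ∧ c 5 = 0) :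
    HasKillingBasis A ![v₀, v₁, v₂, v₃, v₄, v₅] := by
  refine Elem.hasKillingBasis (m := 4) ![e₀, e₁, e₂, e₃, e₄, e₅] ?_ ?_
    (LinearMap.pi ![entry 0 0, entry 0 1, entry 1 0, entry 1 1]) (fun E _ h => ?_) le_rfl ?_
  · intro i
    fin_cases i
    exacts [h₀.eq, h₁.eq, h₂.eq, h₃.eq, h₄.eq, h₅.eq]
  · intro i
    fin_cases i
    exacts [h₀.killing, h₁.killing, h₂.killing, h₃.killing, h₄.killing, h₅.killing]
  · obtain ⟨a, b, c, d, rfl⟩ := exists_eq_frameOf E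
    exact frameOf_eq_zero.2 ⟨congrFun h 0, congrFun h 1, congrFun h 2, congrFun h 3⟩
  · intro c hc hc'
    obtain ⟨c0, c1, c2, c3, c4, c5⟩ := hli c hc hc'
    funext i
    fin_cases i
    exacts [c0, c1, c2, c3, c4, c5]

theorem hasKillingBasis_four {A : Coeffs} {v₀ v₁ v₂ v₃ : VectorField}
    {e₀ e₁ e₂ e₃ : Fin 2 → Elem}
    (hK : ∀ a b c d, frameOf a b c d ∈ reducedSpan A → a = 0 ∧ c = 0)
    (h₀ : IsKillingElem A v₀ e₀) (h₁ : IsKillingElem A v₁ e₁)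
    (h₂ : IsKillingElem A v₂ e₂) (h₃ : IsKillingElem A v₃ e₃)
    (hli : ∀ c : Fin 4 → ℝ, (∀ k, ∑ i, c i * (![e₀, e₁, e₂, e₃] i k).eval 1 0 = 0) →
      (∀ j k, ∑ i, c i * ((![e₀, e₁, e₂, e₃] i k).diff j).eval 1 0 = 0) →
      c 0 = 0 ∧ c 1 = 0 ∧ c 2 = 0 ∧ c 3 = 0) :
    HasKillingBasis A ![v₀, v₁, v₂, v₃] := by
  refine Elem.hasKillingBasis (m := 2) ![e₀, e₁, e₂, e₃] ?_ ?_
    (LinearMap.pi ![entry 0 1, entry 1 1]) (fun E hE h => ?_) le_rfl ?_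
  · intro i
    fin_cases i
    exacts [h₀.eq, h₁.eq, h₂.eq, h₃.eq]
  · intro i
    fin_cases i
    exacts [h₀.killing, h₁.killing, h₂.killing, h₃.killing]
  · obtain ⟨a, b, c, d, rfl⟩ := exists_eq_frameOf E
    obtain ⟨ha, hc⟩ := hK a b c d hE
    exact frameOf_eq_zero.2 ⟨ha, congrFun h 0, hc, congrFun h 1⟩
  · intro c hc hc'
    obtain ⟨c0, c1, c2, c3⟩ := hli c hc hc'
    funext i
    fin_cases i
    exacts [c0, c1, c2, c3]

/-- All three-dimensional Killing algebras of the classification are spanned by `X`, `∂₂` and a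
field detected by the entry `c` of its reduced derivative. -/
theorem hasKillingBasis_three {A : Coeffs} {v : VectorField} {e : Fin 2 → Elem}
    (hK : ∀ a b d, frameOf a b 0 d ∈ reducedSpan A → a = 0 ∧ b = 0 ∧ d = 0)
    (h : IsKillingElem A v e) (hne : ((e 0).diff 1).eval 1 0 ≠ 0) :
    HasKillingBasis A ![X, D₂, v] := by
  refine Elem.hasKillingBasis (m := 1) ![xElem, dElem, e] ?_ ?_
    (LinearMap.pi ![entry 1 0]) (fun E hE h => ?_) le_rfl ?_
  · intro i
    fin_cases i
    exacts [(isKillingElem_X A).eq, (isKillingElem_D₂ A).eq, h.eq]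
  · intro i
    fin_cases i
    exacts [(isKillingElem_X A).killing, (isKillingElem_D₂ A).killing, h.killing]
  · obtain ⟨a, b, c, d, rfl⟩ := exists_eq_frameOf E
    obtain rfl : c = 0 := congrFun h 0
    obtain ⟨ha, hb, hd⟩ := hK a b d hE
    exact frameOf_eq_zero.2 ⟨ha, hb, rfl, hd⟩
  · intro c h1 h2
    have e2 := h2 1 0
    have e0 := h1 0
    have e1 := h1 1
    simp [Fin.sum_univ_succ, xElem, dElem, Elem.eval, Elem.diff, hne] at e2
    simp [Fin.sum_univ_succ, xElem, dElem, Elem.eval, e2] at e0 e1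
    funext i
    fin_cases i
    exacts [e0, e1, e2]

/-- Models which are not linearly equivalent to a listed one. -/
theorem hasKillingBasis_of_not_classified {A : Coeffs} (h : ¬ IsClassified A) :
    HasKillingBasis A ![X, D₂] := by
  refine hasKillingBasis_of_eq_bot ?_
  by_contra hK
  exact h ((isProlonged_reducedSpan A).isClassified hK)

/-! ### Bounds for the span of the reduced derivatives -/

theorem eq_bot_of_frameOf {K : Submodule ℝ Frame}
    (h : ∀ a b c d, frameOf a b c d ∈ K → a = 0 ∧ b = 0 ∧ c = 0 ∧ d = 0) : K = ⊥ := by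
  rw [Submodule.eq_bot_iff]
  intro E hE
  obtain ⟨a, b, c, d, rfl⟩ := exists_eq_frameOf E
  exact frameOf_eq_zero.2 (h a b c d hE)

namespace IsProlonged

variable {K : Submodule ℝ Frame} {p q r s m n t u a b c d : ℝ}

/-- Torsion `(0, u)` with `u ≠ 0` leaves at most the two dimensions `a = c = 0`. -/
theorem of_torsion_one_eq_zero (h : IsProlonged (model p q r s m n 0 u) K) (hu : u ≠ 0)
    (hE : frameOf a b c d ∈ K) : a = 0 ∧ c = 0 := by
  obtain ⟨h1, h2⟩ := h.torsion hE
  exact ⟨by simpa [hu] using h2.symm, by simpa [hu] using h1⟩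

/-- The integrability conditions also leave at most these two dimensions, unless `s = 0` or
`s = p + 1`. -/
theorem of_fibred_nonflat (h : IsProlonged (model p q 0 s 0 0 t u) K) (hs : s ≠ 0)
    (hps : s - p - 1 ≠ 0) (hE : frameOf a b c d ∈ K) : a = 0 ∧ c = 0 := by
  obtain ⟨a₁, b₁, c₁, d₁, a₂, b₂, c₂, d₂, ⟨e1, e2, e3, e4⟩, ⟨f1, f2, f3, f4⟩, g1, g2, g3, g4⟩ :=
    h.integrability hE
  subst e1 e2 e3 e4 f1 f2 f3 f4
  have hc : c = 0 := mul_left_cancel₀ (mul_ne_zero hs hps) (by linear_combination g1)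
  subst hc
  exact ⟨mul_left_cancel₀ (mul_ne_zero hs hps) (by linear_combination -(1 / 2) * g2), rfl⟩

/-- With torsion `(t, 0)`, `t ≠ 0`, an element is determined by its entry `c`. -/
theorem of_fibred_torsion (h : IsProlonged (model p q 0 s 0 0 t 0) K) (ht : t ≠ 0)
    (hE : frameOf a b 0 d ∈ K) : a = 0 ∧ b = 0 ∧ d = 0 := by
  obtain ⟨h1, h2⟩ := h.torsion hE
  obtain ⟨h3, -⟩ := h.torsion (h.mem_zero hE)
  obtain ⟨-, h4⟩ := h.torsion (h.mem_one hE)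
  have hd : d = 0 := by simpa [ht] using h1.symm
  have hb : b = 0 := by simpa [ht] using h2
  subst hd hb
  exact ⟨mul_left_cancel₀ ht (by linarith), rfl, rfl⟩

/-- For the models related to the field `x² (2 x¹ ∂₁ + x² ∂₂)`, an element is determined by its
entry `c`. -/
theorem of_half (h : IsProlonged (model (-(3 / 2)) 0 r (-(1 / 2)) m (2 * r) t u) K)
    (hrm : r ≠ 0 ∨ m ≠ 0) (hE : frameOf a b c d ∈ K) : a = 0 ∧ b = 0 ∧ d = 0 := by
  -- the linear relation between `a`, `b`, `d` which the integrability conditions give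
  have key : ∀ {a b c d}, frameOf a b c d ∈ K →
      (r ^ 2 - 2 * m) * b + 3 / 2 * r * (a + d) = 0 ∧ (4 * m - 2 * r ^ 2) * d = 0 := by
    intro a b c d hE
    obtain ⟨a₁, b₁, c₁, d₁, a₂, b₂, c₂, d₂, ⟨e1, e2, e3, e4⟩, ⟨f1, f2, f3, f4⟩, g1, g2, g3, g4⟩ :=
      h.integrability hE
    subst e1 e2 e3 e4 f1 f2 f3 f4
    exact ⟨by linear_combination g4, by linear_combination g3⟩
  obtain ⟨k1, k2⟩ := key hE
  obtain ⟨l1, l2⟩ := key (h.mem_zero hE)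
  obtain ⟨m1, m2⟩ := key (h.mem_one hE)
  by_cases hr : r = 0
  · subst hr
    have hm : m ≠ 0 := hrm.resolve_left fun h => h rfl
    exact ⟨mul_left_cancel₀ hm (by linear_combination -m1), mul_left_cancel₀ hm
      (by linear_combination -(1 / 2) * k1), mul_left_cancel₀ hm (by linear_combination k2 / 4)⟩
  by_cases hm : 4 * m - 2 * r ^ 2 = 0
  · obtain rfl : m = r ^ 2 / 2 := by linarith
    have ha : d = -a := by
      have : a + d = 0 := mul_left_cancel₀ hr (by linear_combination (2 / 3) * k1)
      linarith
    subst ha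
    have ha : a = 0 := mul_left_cancel₀ (mul_ne_zero hr hr) (by linear_combination (2 / 9) * m1)
    subst ha
    exact ⟨rfl, mul_left_cancel₀ (mul_ne_zero hr hr) (by linear_combination -(2 / 9) * l1),
      by ring⟩
  · have hd : d = 0 := (mul_eq_zero.1 k2).resolve_left hm
    have hd₁ := (mul_eq_zero.1 l2).resolve_left hm
    have hd₂ := (mul_eq_zero.1 m2).resolve_left hm
    subst hd
    have ha : a = -2 * r * b := by linear_combination -2 * hd₁
    subst ha
    have hb : b = 0 := mul_left_cancel₀ (mul_ne_zero hr hr)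
      (by linear_combination -(1 / 2) * k1 - hd₂)
    subst hb
    exact ⟨by ring, rfl, rfl⟩

/-- For the symmetric part of the hyperbolic plane or of its Lorentzian analogue, all elements are
multiples of `((0, 1), (-m, 0))`. -/
theorem of_hyperbolic (h : IsProlonged (model (-1) 0 0 (-1) m 0 t u) K) (hm : m ≠ 0)
    (hE : frameOf a b c d ∈ K) : a = 0 ∧ d = 0 ∧ c = -(m * b) := by
  obtain ⟨a₁, b₁, c₁, d₁, a₂, b₂, c₂, d₂, ⟨e1, e2, e3, e4⟩, ⟨f1, f2, f3, f4⟩, g1, g2, g3, g4⟩ :=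
    h.integrability hE
  obtain ⟨a₁', b₁', c₁', d₁', a₂', b₂', c₂', d₂', ⟨e1', e2', e3', e4'⟩, ⟨f1', f2', f3', f4'⟩,
    g1', g2', g3', g4'⟩ := h.integrability (h.mem_one hE)
  subst e1 e2 e3 e4 f1 f2 f3 f4 e1' e2' e3' e4' f1' f2' f3' f4'
  have ha : a = 0 := by linarith
  have hc : c = -(m * b) := by linarith
  subst ha hc
  exact ⟨rfl, mul_left_cancel₀ hm (by linarith), rfl⟩

/-- Nonzero torsion destroys all symmetries of `N₁⁶(±)` beyond `X` and `∂₂`. -/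
theorem eq_bot_of_quadric (h : IsProlonged (model 1 0 0 0 m 0 t u) K) (hm : m ≠ 0)
    (htu : t ≠ 0 ∨ u ≠ 0) : K = ⊥ := by
  refine eq_bot_of_frameOf fun a b c d hE => ?_
  obtain ⟨h1, h2⟩ := h.torsion hE
  obtain ⟨h3, h4⟩ := h.torsion (h.mem_zero hE)
  obtain ⟨h5, h6⟩ := h.torsion (h.mem_one hE)
  by_cases ht : t = 0
  · subst ht
    have hu : u ≠ 0 := htu.resolve_left fun h => h rfl
    have hc : c = 0 := by simpa [hu] using h1
    have ha : a = 0 := by simpa [hu] using h2.symm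
    subst hc ha
    exact ⟨rfl, by simpa [hu, hm] using h3, rfl, by simpa [hu, hm] using h5⟩
  · obtain ⟨τ, rfl⟩ : ∃ τ, u = t * τ := ⟨u / t, by field_simp⟩
    have hd : d = τ * c := mul_left_cancel₀ ht (by linarith)
    have hb : b = τ * a := mul_left_cancel₀ ht (by linarith)
    subst hd hb
    have hτa : τ * a = 0 := mul_left_cancel₀ ht (by linear_combination (1 / 3) * h4)
    have hτc : τ * c = 0 := mul_left_cancel₀ ht (by linear_combination (1 / 2) * h6 - (1 / 2) * t * m * τ * hτa)
    have ha : a = 0 := mul_left_cancel₀ ht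
      (by linear_combination h3 + t * hτc + t * τ * m * hτa)
    subst ha
    have hc : c = 0 := mul_left_cancel₀ ht (by linear_combination h5 + 2 * t * τ * m * hτc)
    exact ⟨rfl, by ring, hc, hτc⟩

end IsProlonged

open Elem

/-! ### Four-dimensional Killing algebras -/

theorem isKillingElem_y (p s u : ℝ) :
    IsKillingElem (model p 0 0 s 0 0 0 u) (field fun _ y => (0, y))
      ![const 0, .y] where
  eq := field_eq_vectorField fun _ _ _ => rfl
  killing x y _ i j k := by
    fin_cases i <;> fin_cases j <;> fin_cases k <;>
      simp [killingLHS, diff, eval, model, typeB, Fin.sum_univ_two]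

theorem isKillingElem_powX (s u θ : ℝ) :
    IsKillingElem (model (-1 + θ + 2 * s) 0 0 s 0 0 0 u) (field fun x _ => (0, x ^ θ))
      ![const 0, powX θ] where
  eq := field_eq_vectorField fun _ _ _ => rfl
  killing x y hx i j k := by
    fin_cases i <;> fin_cases j <;> fin_cases k <;>
      simp [killingLHS, diff, eval, model, typeB, Fin.sum_univ_two] <;> field_simp <;> ring

theorem isKillingElem_logX (s u : ℝ) :
    IsKillingElem (model (2 * s - 1) 0 0 s 0 0 0 u) (field fun x _ => (0, Real.log x))
      ![const 0, logX] where
  eq := field_eq_vectorField fun _ _ _ => rfl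
  killing x y hx i j k := by
    fin_cases i <;> fin_cases j <;> fin_cases k <;>
      simp [killingLHS, diff, eval, model, typeB, Fin.sum_univ_two] <;> field_simp <;> ring

theorem isKillingElem_x (q s u : ℝ) :
    IsKillingElem (model (2 * s) q 0 s 0 0 0 u) (field fun x _ => (0, x))
      ![const 0, .x] where
  eq := field_eq_vectorField fun _ _ _ => rfl
  killing x y hx i j k := by
    fin_cases i <;> fin_cases j <;> fin_cases k <;>
      simp [killingLHS, diff, eval, model, typeB, Fin.sum_univ_two] <;> field_simp <;> ring

theorem isKillingElem_yxlogX (s u : ℝ) :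
    IsKillingElem (model (2 * s) 1 0 s 0 0 0 u) (field fun x y => (0, y + x * Real.log x))
      ![const 0, add .y (mul .x logX)] where
  eq := field_eq_vectorField fun _ _ _ => rfl
  killing x y hx i j k := by
    fin_cases i <;> fin_cases j <;> fin_cases k <;>
      simp [killingLHS, diff, eval, model, typeB, Fin.sum_univ_two] <;> field_simp <;> ring

theorem isKillingElem_xxlogX (s u : ℝ) :
    IsKillingElem (model (2 * s) 1 0 s 0 0 0 u) (field fun x _ => (x, x * -Real.log x))
      ![.x, mul .x (mul (const (-1)) logX)] where
  eq := field_eq_vectorField fun _ _ _ => by simp [eval]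
  killing x y hx i j k := by
    fin_cases i <;> fin_cases j <;> fin_cases k <;>
      simp [killingLHS, diff, eval, model, typeB, Fin.sum_univ_two] <;> field_simp <;> ring


theorem hasKillingBasis_powX {s u θ : ℝ} (hθ : θ ≠ 0)
    (hK : ∀ a b c d, frameOf a b c d ∈ reducedSpan (model (-1 + θ + 2 * s) 0 0 s 0 0 0 u) →
      a = 0 ∧ c = 0) :
    HasKillingBasis (model (-1 + θ + 2 * s) 0 0 s 0 0 0 u)
      ![X, D₂, field fun _ y => (0, y), field fun x _ => (0, x ^ θ)] := by
  refine hasKillingBasis_four hK (isKillingElem_X _) (isKillingElem_D₂ _)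
    (isKillingElem_y _ _ _) (isKillingElem_powX _ _ _) fun c h1 h2 => ?_
  simp only [Fin.forall_fin_two] at h1 h2
  simp [Fin.sum_univ_succ, xElem, dElem, eval, diff] at h1 h2
  grind

theorem hasKillingBasis_logX {s u : ℝ}
    (hK : ∀ a b c d, frameOf a b c d ∈ reducedSpan (model (2 * s - 1) 0 0 s 0 0 0 u) →
      a = 0 ∧ c = 0) :
    HasKillingBasis (model (2 * s - 1) 0 0 s 0 0 0 u)
      ![X, D₂, field fun _ y => (0, y), field fun x _ => (0, Real.log x)] := by
  refine hasKillingBasis_four hK (isKillingElem_X _) (isKillingElem_D₂ _)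
    (isKillingElem_y _ _ _) (isKillingElem_logX _ _) fun c h1 h2 => ?_
  simp only [Fin.forall_fin_two] at h1 h2
  simp [Fin.sum_univ_succ, xElem, dElem, eval, diff] at h1 h2
  grind

theorem hasKillingBasis_yxlogX {s u : ℝ}
    (hK : ∀ a b c d, frameOf a b c d ∈ reducedSpan (model (2 * s) 1 0 s 0 0 0 u) →
      a = 0 ∧ c = 0) :
    HasKillingBasis (model (2 * s) 1 0 s 0 0 0 u)
      ![X, D₂, field fun x _ => (0, x), field fun x y => (0, y + x * Real.log x)] := by
  refine hasKillingBasis_four hK (isKillingElem_X _) (isKillingElem_D₂ _)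
    (isKillingElem_x _ _ _) (isKillingElem_yxlogX _ _) fun c h1 h2 => ?_
  simp only [Fin.forall_fin_two] at h1 h2
  simp [Fin.sum_univ_succ, xElem, dElem, eval, diff] at h1 h2
  grind

theorem hasKillingBasis_xxlogX {s u : ℝ}
    (hK : ∀ a b c d, frameOf a b c d ∈ reducedSpan (model (2 * s) 1 0 s 0 0 0 u) →
      a = 0 ∧ c = 0) :
    HasKillingBasis (model (2 * s) 1 0 s 0 0 0 u)
      ![X, D₂, field fun x _ => (0, x), field fun x _ => (x, x * -Real.log x)] := by
  refine hasKillingBasis_four hK (isKillingElem_X _) (isKillingElem_D₂ _)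
    (isKillingElem_x _ _ _) (isKillingElem_xxlogX _ _) fun c h1 h2 => ?_
  simp only [Fin.forall_fin_two] at h1 h2
  simp [Fin.sum_univ_succ, xElem, dElem, eval, diff] at h1 h2
  grind

theorem hasKillingBasis_x_y {u : ℝ}
    (hK : ∀ a b c d, frameOf a b c d ∈ reducedSpan (model 0 0 0 0 0 0 0 u) → a = 0 ∧ c = 0) :
    HasKillingBasis (model 0 0 0 0 0 0 0 u)
      ![X, D₂, field fun x _ => (0, x), field fun _ y => (0, y)] := by
  refine hasKillingBasis_four hK (isKillingElem_X _) (isKillingElem_D₂ _)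
    (by simpa using isKillingElem_x 0 0 u) (isKillingElem_y _ _ _) fun c h1 h2 => ?_
  simp only [Fin.forall_fin_two] at h1 h2
  simp [Fin.sum_univ_succ, xElem, dElem, eval, diff] at h1 h2
  grind

/-! ### Six-dimensional Killing algebras -/

theorem isKillingElem_flat_one :
    IsKillingElem (model 0 0 0 0 0 0 0 0) (field fun _ _ => (1, 0))
      ![const 1, const 0] where
  eq := field_eq_vectorField fun _ _ _ => rfl
  killing x y _ i j k := by
    fin_cases i <;> fin_cases j <;> fin_cases k <;>
      simp [killingLHS, diff, eval, model, typeB, Fin.sum_univ_two]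

theorem isKillingElem_flat_x :
    IsKillingElem (model 0 0 0 0 0 0 0 0) (field fun x _ => (x, 0))
      ![.x, const 0] where
  eq := field_eq_vectorField fun _ _ _ => rfl
  killing x y _ i j k := by
    fin_cases i <;> fin_cases j <;> fin_cases k <;>
      simp [killingLHS, diff, eval, model, typeB, Fin.sum_univ_two]

theorem isKillingElem_flat_y :
    IsKillingElem (model 0 0 0 0 0 0 0 0) (field fun _ y => (y, 0))
      ![.y, const 0] where
  eq := field_eq_vectorField fun _ _ _ => rfl
  killing x y _ i j k := by
    fin_cases i <;> fin_cases j <;> fin_cases k <;>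
      simp [killingLHS, diff, eval, model, typeB, Fin.sum_univ_two]

theorem hasKillingBasis_flat :
    HasKillingBasis (model 0 0 0 0 0 0 0 0)
      ![field fun _ _ => (1, 0),
        D₂,
        field fun x _ => (x, 0),
        field fun x _ => (0, x),
        field fun _ y => (y, 0),
        field fun _ y => (0, y)] := by
  refine hasKillingBasis_six isKillingElem_flat_one
    (isKillingElem_D₂ _)
    isKillingElem_flat_x
    (by simpa using isKillingElem_x 0 0 0)
    isKillingElem_flat_y
    (isKillingElem_y _ _ _) fun c h1 h2 => ?_
  simp only [Fin.forall_fin_two] at h1 h2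
  simp [Fin.sum_univ_succ, dElem, eval, diff] at h1 h2
  grind

theorem isKillingElem_quadric_invX (m : ℝ) :
    IsKillingElem (model 1 0 0 0 m 0 0 0) (field fun x _ => (1 / x, 0))
      ![invX, const 0] where
  eq := field_eq_vectorField fun _ _ _ => by simp [eval]
  killing x y hx i j k := by
    fin_cases i <;> fin_cases j <;> fin_cases k <;>
      simp [killingLHS, diff, eval, model, typeB, Fin.sum_univ_two] <;> field_simp <;> ring

theorem isKillingElem_quadric_yinvX (m : ℝ) :
    IsKillingElem (model 1 0 0 0 m 0 0 0) (field fun x y => (y / x, 0))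
      ![mul .y invX, const 0] where
  eq := field_eq_vectorField fun _ _ _ => by simp [eval, div_eq_mul_inv]
  killing x y hx i j k := by
    fin_cases i <;> fin_cases j <;> fin_cases k <;>
      simp [killingLHS, diff, eval, model, typeB, Fin.sum_univ_two] <;> field_simp <;> ring

theorem isKillingElem_quadric_sq {m : ℝ} (hm : m = 1 ∨ m = -1) :
    IsKillingElem (model 1 0 0 0 m 0 0 0) (field fun x y => ((x ^ 2 + m * y ^ 2) / x, 0))
      ![add .x (mul (const m) (mul (mul .y .y) invX)), const 0] where
  eq := field_eq_vectorField fun _ _ _ => by simp [eval]; field_simp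
  killing x y hx i j k := by
    rcases hm with rfl | rfl <;>
    fin_cases i <;> fin_cases j <;> fin_cases k <;>
      simp [killingLHS, diff, eval, model, typeB, Fin.sum_univ_two] <;> field_simp <;> ring

theorem isKillingElem_quadric_cube {m : ℝ} (hm : m = 1 ∨ m = -1) :
    IsKillingElem (model 1 0 0 0 m 0 0 0) (field fun x y =>
      (-(y * (y ^ 2 + m * x ^ 2)) / x, x ^ 2 + m * y ^ 2))
      ![mul (mul (const (-1)) .y) (add (mul (mul .y .y) invX) (mul (const m) .x)),
        add (mul .x .x) (mul (const m) (mul .y .y))] where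
  eq := field_eq_vectorField fun _ _ _ => by simp [eval]; field_simp; simp
  killing x y hx i j k := by
    rcases hm with rfl | rfl <;>
    fin_cases i <;> fin_cases j <;> fin_cases k <;>
      simp [killingLHS, diff, eval, model, typeB, Fin.sum_univ_two] <;> field_simp <;> ring

theorem hasKillingBasis_quadric {m : ℝ} (hm : m = 1 ∨ m = -1) :
    HasKillingBasis (model 1 0 0 0 m 0 0 0)
      ![X,
        D₂,
        field fun x _ => (1 / x, 0),
        field fun x y => (y / x, 0),
        field fun x y => ((x ^ 2 + m * y ^ 2) / x, 0),
        field fun x y => (-(y * (y ^ 2 + m * x ^ 2)) / x, x ^ 2 + m * y ^ 2)] := by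
  refine hasKillingBasis_six (isKillingElem_X _)
    (isKillingElem_D₂ _)
    (isKillingElem_quadric_invX m)
    (isKillingElem_quadric_yinvX m)
    (isKillingElem_quadric_sq hm)
    (isKillingElem_quadric_cube hm) fun c h1 h2 => ?_
  simp only [Fin.forall_fin_two] at h1 h2
  simp [Fin.sum_univ_succ, xElem, dElem, eval, diff] at h1 h2
  grind

theorem isKillingElem_powNeg_x (c : ℝ) :
    IsKillingElem (model (-1 + c) 0 0 c 0 0 0 0) (field fun x _ => (x, 0))
      ![.x, const 0] where
  eq := field_eq_vectorField fun _ _ _ => rfl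
  killing x y hx i j k := by
    fin_cases i <;> fin_cases j <;> fin_cases k <;>
      simp [killingLHS, diff, eval, model, typeB, Fin.sum_univ_two] <;> field_simp <;> ring

theorem isKillingElem_powNeg_xpow (c : ℝ) :
    IsKillingElem (model (-1 + c) 0 0 c 0 0 0 0) (field fun x y => (x ^ (-c) * x, x ^ (-c) * (-c * y)))
      ![mul (powX (-c)) .x, mul (powX (-c)) (mul (const (-c)) .y)] where
  eq := field_eq_vectorField fun _ _ _ => rfl
  killing x y hx i j k := by
    fin_cases i <;> fin_cases j <;> fin_cases k <;>
      simp [killingLHS, diff, eval, model, typeB, Fin.sum_univ_two] <;> field_simp <;> ring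

theorem isKillingElem_powNeg_yx (c : ℝ) :
    IsKillingElem (model (-1 + c) 0 0 c 0 0 0 0) (field fun x y => (y * x, y * (-c * y)))
      ![mul .y .x, mul .y (mul (const (-c)) .y)] where
  eq := field_eq_vectorField fun _ _ _ => rfl
  killing x y hx i j k := by
    fin_cases i <;> fin_cases j <;> fin_cases k <;>
      simp [killingLHS, diff, eval, model, typeB, Fin.sum_univ_two] <;> field_simp <;> ring

theorem hasKillingBasis_powNeg {c : ℝ} (hc : c ≠ 0) :
    HasKillingBasis (model (-1 + c) 0 0 c 0 0 0 0)
      ![field fun x _ => (x, 0),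
        field fun _ y => (0, y),
        D₂,
        field fun x _ => (0, x ^ (-c)),
        field fun x y => (x ^ (-c) * x, x ^ (-c) * (-c * y)),
        field fun x y => (y * x, y * (-c * y))] := by
  refine hasKillingBasis_six (isKillingElem_powNeg_x c)
    (isKillingElem_y _ _ _)
    (isKillingElem_D₂ _)
    (by have h := isKillingElem_powX c 0 (-c)
        rwa [show -1 + -c + 2 * c = -1 + c by ring] at h)
    (isKillingElem_powNeg_xpow c)
    (isKillingElem_powNeg_yx c) fun c h1 h2 => ?_
  simp only [Fin.forall_fin_two] at h1 h2
  simp [Fin.sum_univ_succ, dElem, eval, diff] at h1 h2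
  grind

theorem isKillingElem_shearNeg_sq :
    IsKillingElem (model (2 * -1) 1 0 (-1) 0 0 0 0) (field fun x y => (-x ^ 2, x * (x - y)))
      ![mul (const (-1)) (mul .x .x), mul .x (add .x (mul (const (-1)) .y))] where
  eq := field_eq_vectorField fun x y _ => by simp [eval, sub_eq_add_neg, sq]
  killing x y hx i j k := by
    fin_cases i <;> fin_cases j <;> fin_cases k <;>
      simp [killingLHS, diff, eval, model, typeB, Fin.sum_univ_two] <;> field_simp <;> ring

theorem isKillingElem_shearNeg_log :
    IsKillingElem (model (2 * -1) 1 0 (-1) 0 0 0 0) (field fun x y =>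
      ((y + x * Real.log x) * (-x), (y + x * Real.log x) * (x - y)))
      ![mul (add .y (mul .x logX)) (mul (const (-1)) .x),
        mul (add .y (mul .x logX)) (add .x (mul (const (-1)) .y))] where
  eq := field_eq_vectorField fun x y _ => by simp [eval]; ring_nf; simp
  killing x y hx i j k := by
    fin_cases i <;> fin_cases j <;> fin_cases k <;>
      simp [killingLHS, diff, eval, model, typeB, Fin.sum_univ_two] <;> field_simp <;> ring

theorem hasKillingBasis_shearNeg :
    HasKillingBasis (model (2 * -1) 1 0 (-1) 0 0 0 0)
      ![X,
        D₂,
        field fun x _ => (0, x),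
        field fun x y => (0, y + x * Real.log x),
        field fun x y => (-x ^ 2, x * (x - y)),
        field fun x y => ((y + x * Real.log x) * (-x), (y + x * Real.log x) * (x - y))] := by
  refine hasKillingBasis_six (isKillingElem_X _)
    (isKillingElem_D₂ _)
    (isKillingElem_x _ _ _)
    (isKillingElem_yxlogX _ _)
    isKillingElem_shearNeg_sq
    isKillingElem_shearNeg_log fun c h1 h2 => ?_
  simp only [Fin.forall_fin_two] at h1 h2
  simp [Fin.sum_univ_succ, xElem, dElem, eval, diff] at h1 h2
  grind

theorem isKillingElem_shear_log :
    IsKillingElem (model (2 * 0) 1 0 0 0 0 0 0) (field fun x _ => (1, -(1 + Real.log x)))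
      ![const 1, mul (const (-1)) (add (const 1) logX)] where
  eq := field_eq_vectorField fun x y _ => by simp [eval]
  killing x y hx i j k := by
    fin_cases i <;> fin_cases j <;> fin_cases k <;>
      simp [killingLHS, diff, eval, model, typeB, Fin.sum_univ_two] <;> field_simp <;> ring

theorem isKillingElem_shear_log_sq :
    IsKillingElem (model (2 * 0) 1 0 0 0 0 0 0) (field fun x y =>
      (y + x * Real.log x, (y + x * Real.log x) * -(1 + Real.log x)))
      ![add .y (mul .x logX),
        mul (add .y (mul .x logX)) (mul (const (-1)) (add (const 1) logX))] where
  eq := field_eq_vectorField fun x y _ => by simp [eval]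
  killing x y hx i j k := by
    fin_cases i <;> fin_cases j <;> fin_cases k <;>
      simp [killingLHS, diff, eval, model, typeB, Fin.sum_univ_two] <;> field_simp <;> ring

theorem hasKillingBasis_shear :
    HasKillingBasis (model (2 * 0) 1 0 0 0 0 0 0)
      ![X,
        D₂,
        field fun x _ => (0, x),
        field fun x y => (0, y + x * Real.log x),
        field fun x _ => (1, -(1 + Real.log x)),
        field fun x y => (y + x * Real.log x, (y + x * Real.log x) * -(1 + Real.log x))] := by
  refine hasKillingBasis_six (isKillingElem_X _)
    (isKillingElem_D₂ _)
    (isKillingElem_x _ _ _)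
    (isKillingElem_yxlogX _ _)
    isKillingElem_shear_log
    isKillingElem_shear_log_sq fun c h1 h2 => ?_
  simp only [Fin.forall_fin_two] at h1 h2
  simp [Fin.sum_univ_succ, xElem, dElem, eval, diff] at h1 h2
  grind

theorem isKillingElem_log_xy :
    IsKillingElem (model (2 * 0 - 1) 0 0 0 0 0 0 0) (field fun x y => (x * y, 0))
      ![mul .x .y, const 0] where
  eq := field_eq_vectorField fun _ _ _ => rfl
  killing x y hx i j k := by
    fin_cases i <;> fin_cases j <;> fin_cases k <;>
      simp [killingLHS, diff, eval, model, typeB, Fin.sum_univ_two] <;> field_simp <;> ring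

theorem isKillingElem_log_xlogX :
    IsKillingElem (model (2 * 0 - 1) 0 0 0 0 0 0 0) (field fun x _ => (x * Real.log x, 0))
      ![mul .x logX, const 0] where
  eq := field_eq_vectorField fun _ _ _ => rfl
  killing x y hx i j k := by
    fin_cases i <;> fin_cases j <;> fin_cases k <;>
      simp [killingLHS, diff, eval, model, typeB, Fin.sum_univ_two] <;> field_simp <;> ring

theorem hasKillingBasis_log :
    HasKillingBasis (model (2 * 0 - 1) 0 0 0 0 0 0 0)
      ![X,
        D₂,
        field fun _ y => (0, y),
        field fun x y => (x * y, 0),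
        field fun x _ => (0, Real.log x),
        field fun x _ => (x * Real.log x, 0)] := by
  refine hasKillingBasis_six (isKillingElem_X _)
    (isKillingElem_D₂ _)
    (isKillingElem_y _ _ _)
    isKillingElem_log_xy
    (isKillingElem_logX _ _)
    isKillingElem_log_xlogX fun c h1 h2 => ?_
  simp only [Fin.forall_fin_two] at h1 h2
  simp [Fin.sum_univ_succ, xElem, dElem, eval, diff] at h1 h2
  grind

theorem isKillingElem_pow_pow (c : ℝ) :
    IsKillingElem (model c 0 0 0 0 0 0 0) (field fun x _ => (x ^ (-c), 0))
      ![powX (-c), const 0] where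
  eq := field_eq_vectorField fun _ _ _ => rfl
  killing x y hx i j k := by
    fin_cases i <;> fin_cases j <;> fin_cases k <;>
      simp [killingLHS, diff, eval, model, typeB, Fin.sum_univ_two] <;> field_simp <;> ring

theorem isKillingElem_pow_powy (c : ℝ) :
    IsKillingElem (model c 0 0 0 0 0 0 0) (field fun x y => (x ^ (-c) * y, 0))
      ![mul (powX (-c)) .y, const 0] where
  eq := field_eq_vectorField fun _ _ _ => rfl
  killing x y hx i j k := by
    fin_cases i <;> fin_cases j <;> fin_cases k <;>
      simp [killingLHS, diff, eval, model, typeB, Fin.sum_univ_two] <;> field_simp <;> ring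

theorem hasKillingBasis_pow {c : ℝ} (hc : c ≠ -1) :
    HasKillingBasis (model c 0 0 0 0 0 0 0)
      ![X,
        D₂,
        field fun _ y => (0, y),
        field fun x _ => (x ^ (-c), 0),
        field fun x y => (x ^ (-c) * y, 0),
        field fun x _ => (0, x ^ (c + 1))] := by
  refine hasKillingBasis_six (isKillingElem_X _)
    (isKillingElem_D₂ _)
    (isKillingElem_y _ _ _)
    (isKillingElem_pow_pow c)
    (isKillingElem_pow_powy c)
    (by have h := isKillingElem_powX 0 0 (c + 1)
        rwa [show -1 + (c + 1) + 2 * 0 = c by ring] at h) fun c h1 h2 => ?_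
  simp only [Fin.forall_fin_two] at h1 h2
  simp [Fin.sum_univ_succ, xElem, dElem, eval, diff] at h1 h2
  grind

/-! ### Fields of the three-dimensional Killing algebras -/

theorem isKillingElem_half (r m t : ℝ) :
    IsKillingElem (model (-(3 / 2)) 0 r (-(1 / 2)) m (2 * r) t 0) (field fun x y => (y * (2 * x), y * y))
      ![mul .y (mul (const 2) .x), mul .y .y] where
  eq := field_eq_vectorField fun _ _ _ => rfl
  killing x y hx i j k := by
    fin_cases i <;> fin_cases j <;> fin_cases k <;>
      simp [killingLHS, diff, eval, model, typeB, Fin.sum_univ_two] <;> field_simp <;> ring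

theorem isKillingElem_half_one (t : ℝ) :
    IsKillingElem (model (-(3 / 2)) 0 0 (-(1 / 2)) 0 0 t 0) (field fun x y => (y * x, y * (1 / 2 * y)))
      ![mul .y .x, mul .y (mul (const (1 / 2)) .y)] where
  eq := field_eq_vectorField fun _ _ _ => rfl
  killing x y hx i j k := by
    fin_cases i <;> fin_cases j <;> fin_cases k <;>
      simp [killingLHS, diff, eval, model, typeB, Fin.sum_univ_two] <;> field_simp <;> ring

theorem isKillingElem_lorentzian :
    IsKillingElem (model (-1) 0 0 (-1) (-1) 0 0 0) (field fun x y => (2 * x * y, y ^ 2 + x ^ 2))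
      ![mul (mul (const 2) .x) .y, add (mul .y .y) (mul .x .x)] where
  eq := field_eq_vectorField fun x y _ => by simp [eval, sq]
  killing x y hx i j k := by
    fin_cases i <;> fin_cases j <;> fin_cases k <;>
      simp [killingLHS, diff, eval, model, typeB, Fin.sum_univ_two] <;> field_simp <;> ring

theorem isKillingElem_hyperbolic :
    IsKillingElem (model (-1) 0 0 (-1) 1 0 0 0) (field fun x y => (2 * x * y, y ^ 2 - x ^ 2))
      ![mul (mul (const 2) .x) .y, add (mul .y .y) (mul (const (-1)) (mul .x .x))] where
  eq := field_eq_vectorField fun x y _ => by simp [eval, sq, sub_eq_add_neg]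
  killing x y hx i j k := by
    fin_cases i <;> fin_cases j <;> fin_cases k <;>
      simp [killingLHS, diff, eval, model, typeB, Fin.sum_univ_two] <;> field_simp <;> ring

/-! ### The families as models -/

theorem N06_eq (t u : ℝ) : N06 t u = model 0 0 0 0 0 0 t u :=
  (model_eq rfl rfl (by ring) (by ring) (by ring) (by ring) rfl rfl).symm

theorem N16_eq (m t u : ℝ) : N16 m t u = model 1 0 0 0 m 0 t u :=
  (model_eq rfl rfl (by ring) (by ring) (by ring) (by ring) rfl rfl).symm

theorem N26_eq (c t u : ℝ) : N26 c t u = model (-1 + c) 0 0 c 0 0 t u :=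
  (model_eq rfl rfl (by ring) (by ring) (by ring) (by ring) rfl rfl).symm

theorem N36_eq (t u : ℝ) : N36 t u = model (2 * -1) 1 0 (-1) 0 0 t u :=
  (model_eq (by ring) rfl (by ring) (by ring) (by ring) (by ring) rfl rfl).symm

theorem N46_eq (t u : ℝ) : N46 t u = model (2 * 0) 1 0 0 0 0 t u :=
  (model_eq (by ring) rfl (by ring) (by ring) (by ring) (by ring) rfl rfl).symm

theorem N56_eq (t u : ℝ) : N56 t u = model (2 * 0 - 1) 0 0 0 0 0 t u :=
  (model_eq (by ring) rfl (by ring) (by ring) (by ring) (by ring) rfl rfl).symm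

theorem N66_eq (c t u : ℝ) : N66 c t u = model c 0 0 0 0 0 t u :=
  (model_eq (by ring) rfl (by ring) (by ring) (by ring) (by ring) rfl rfl).symm

theorem N14_eq (κ t u : ℝ) : N14 κ t u = model (2 * κ) 1 0 κ 0 0 t u :=
  (model_eq (by ring) rfl (by ring) (by ring) (by ring) (by ring) rfl rfl).symm

theorem N24_eq (κ θ t u : ℝ) : N24 κ θ t u = model (-1 + θ + 2 * κ) 0 0 κ 0 0 t u :=
  (model_eq (by ring) rfl (by ring) (by ring) (by ring) (by ring) rfl rfl).symm

theorem N34_eq (c t u : ℝ) : N34 c t u = model (2 * c - 1) 0 0 c 0 0 t u :=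
  (model_eq (by ring) rfl (by ring) (by ring) (by ring) (by ring) rfl rfl).symm

theorem N13_eq (ε t u : ℝ) :
    N13 ε t u = model (-(3 / 2)) 0 0 (-(1 / 2)) (ε * (1 / 2)) (2 * 0) t u :=
  (model_eq (by ring) rfl (by ring) (by ring) (by ring) (by ring) rfl (by ring)).symm

theorem N23_eq (c t u : ℝ) :
    N23 c t u = model (-(3 / 2)) 0 1 (-(1 / 2)) c (2 * 1) t u :=
  (model_eq (by ring) rfl (by ring) (by ring) (by ring) (by ring) rfl (by ring)).symm

theorem N33_eq (t u : ℝ) : N33 t u = model (-1) 0 0 (-1) (-1) 0 t u :=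
  (model_eq (by ring) rfl (by ring) (by ring) (by ring) (by ring) rfl rfl).symm

theorem N43_eq (t u : ℝ) : N43 t u = model (-1) 0 0 (-1) 1 0 t u :=
  (model_eq (by ring) rfl (by ring) (by ring) (by ring) (by ring) rfl rfl).symm

/-! ### Families with a Killing algebra of dimension two or three -/

theorem hasKillingBasis_of_fibred_torsion {p q s t u : ℝ} (ht : t ≠ 0)
    (h : ¬ (s = -(1 / 2) ∧ p = -(3 / 2) ∧ 2 * q * t = -u)) :
    HasKillingBasis (model p q 0 s 0 0 t u) ![X, D₂] :=
  hasKillingBasis_of_eq_bot <| by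
    by_contra hK
    exact h ((isProlonged_reducedSpan _).params_of_fibred ht hK)

theorem hasKillingBasis_of_half_torsion {r m t u : ℝ} (hrm : r ≠ 0 ∨ m ≠ 0) (hu : u ≠ 0) :
    HasKillingBasis (model (-(3 / 2)) 0 r (-(1 / 2)) m (2 * r) t u) ![X, D₂] := by
  refine hasKillingBasis_of_eq_bot (eq_bot_of_frameOf fun a b c d hE => ?_)
  have h := isProlonged_reducedSpan (model (-(3 / 2)) 0 r (-(1 / 2)) m (2 * r) t u)
  obtain ⟨ha, hb, hd⟩ := h.of_half hrm hE
  have := (h.torsion hE).1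
  exact ⟨ha, hb, by simpa [hd, hu] using this, hd⟩

theorem hasKillingBasis_half {r m t : ℝ} (hrm : r ≠ 0 ∨ m ≠ 0) :
    HasKillingBasis (model (-(3 / 2)) 0 r (-(1 / 2)) m (2 * r) t 0)
      ![X, D₂, field fun x y => (y * (2 * x), y * y)] :=
  hasKillingBasis_three (fun _ _ _ hE => (isProlonged_reducedSpan _).of_half hrm hE)
    (isKillingElem_half r m t) (by simp [Elem.diff, Elem.eval])

theorem hasKillingBasis_of_hyperbolic_torsion {m t u : ℝ} (hm : m ≠ 0) (htu : (t, u) ≠ (0, 0)) :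
    HasKillingBasis (model (-1) 0 0 (-1) m 0 t u) ![X, D₂] := by
  refine hasKillingBasis_of_eq_bot (eq_bot_of_frameOf fun a b c d hE => ?_)
  have h := isProlonged_reducedSpan (model (-1) 0 0 (-1) m 0 t u)
  obtain ⟨rfl, rfl, rfl⟩ := h.of_hyperbolic hm hE
  obtain ⟨h1, h2⟩ := h.torsion hE
  have hb : b = 0 := by
    by_contra hb
    have ht : t = 0 := by simpa [hb] using h2
    have hu : u = 0 := by simpa [hb, hm] using h1
    exact htu (by rw [ht, hu])
  exact ⟨rfl, hb, by rw [hb]; ring, rfl⟩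

theorem of_hyperbolic_of_entry {m : ℝ} (hm : m ≠ 0) (a b d : ℝ)
    (hE : frameOf a b 0 d ∈ reducedSpan (model (-1) 0 0 (-1) m 0 0 0)) :
    a = 0 ∧ b = 0 ∧ d = 0 := by
  obtain ⟨ha, hd, hb⟩ := (isProlonged_reducedSpan _).of_hyperbolic hm hE
  exact ⟨ha, by simpa [hm] using hb.symm, hd⟩

/-! ### The list -/

theorem rank_killing_le {A : Coeffs} {n : ℕ} {b : Fin n → VectorField} (h : HasKillingBasis A b) :
    Module.rank ℝ (killing A) ≤ n := by
  rw [← h.2]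
  simpa using (rank_span_le (R := ℝ) (Set.range b)).trans Cardinal.mk_range_le

theorem lemma4p1 :
    -- classification up to linear equivalence; all other models have the minimal algebra
    (∀ A : Coeffs, 2 < Module.rank ℝ (killing A) → ∃ B, IsListed B ∧ LinearlyEquivalent A B) ∧
    (∀ A : Coeffs, (¬ ∃ B, IsListed B ∧ LinearlyEquivalent A B) → HasKillingBasis A ![X, D₂]) ∧
    -- N₀⁶
    (HasKillingBasis (N06 0 0)
        ![field fun _ _ => (1, 0), D₂, field fun x _ => (x, 0), field fun x _ => (0, x),
          field fun _ y => (y, 0), field fun _ y => (0, y)] ∧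
      (∀ T₂, T₂ ≠ 0 → HasKillingBasis (N06 0 T₂)
        ![X, D₂, field fun x _ => (0, x), field fun _ y => (0, y)]) ∧
      (∀ T₁ T₂, T₁ ≠ 0 → HasKillingBasis (N06 T₁ T₂) ![X, D₂])) ∧
    -- N₁⁶(±)
    (∀ ε : ℝ, (ε = 1 ∨ ε = -1) →
      HasKillingBasis (N16 ε 0 0)
        ![X, D₂, field fun x _ => (1 / x, 0), field fun x y => (y / x, 0),
          field fun x y => ((x ^ 2 + ε * y ^ 2) / x, 0),
          field fun x y => (-(y * (y ^ 2 + ε * x ^ 2)) / x, x ^ 2 + ε * y ^ 2)] ∧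
      (∀ T₁ T₂, (T₁, T₂) ≠ (0, 0) → HasKillingBasis (N16 ε T₁ T₂) ![X, D₂])) ∧
    -- N₂⁶(c)
    (∀ c : ℝ, c ≠ 0 →
      HasKillingBasis (N26 c 0 0)
        ![field fun x _ => (x, 0), field fun _ y => (0, y), D₂,
          field fun x _ => (0, x ^ (-c)),
          field fun x y => (x ^ (-c) * x, x ^ (-c) * (-c * y)),
          field fun x y => (y * x, y * (-c * y))] ∧
      (∀ T₂, T₂ ≠ 0 → HasKillingBasis (N26 c 0 T₂)
        ![X, D₂, field fun _ y => (0, y), field fun x _ => (0, x ^ (-c))]) ∧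
      (c = -(1 / 2) → ∀ T₁, T₁ ≠ 0 → HasKillingBasis (N26 c T₁ 0)
        ![X, D₂, field fun x y => (y * x, y * (1 / 2 * y))]) ∧
      (∀ T₁ T₂, T₁ ≠ 0 → ¬ (c = -(1 / 2) ∧ T₂ = 0) →
        HasKillingBasis (N26 c T₁ T₂) ![X, D₂])) ∧
    -- N₃⁶
    (HasKillingBasis (N36 0 0)
        ![X, D₂, field fun x _ => (0, x), field fun x y => (0, y + x * Real.log x),
          field fun x y => (-x ^ 2, x * (x - y)),
          field fun x y => ((y + x * Real.log x) * (-x), (y + x * Real.log x) * (x - y))] ∧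
      (∀ T₂, T₂ ≠ 0 → HasKillingBasis (N36 0 T₂)
        ![X, D₂, field fun x _ => (0, x), field fun x y => (0, y + x * Real.log x)]) ∧
      (∀ T₁ T₂, T₁ ≠ 0 → HasKillingBasis (N36 T₁ T₂) ![X, D₂])) ∧
    -- N₄⁶
    (HasKillingBasis (N46 0 0)
        ![X, D₂, field fun x _ => (0, x), field fun x y => (0, y + x * Real.log x),
          field fun x _ => (1, -(1 + Real.log x)),
          field fun x y => (y + x * Real.log x, (y + x * Real.log x) * -(1 + Real.log x))] ∧
      (∀ T₂, T₂ ≠ 0 → HasKillingBasis (N46 0 T₂)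
        ![X, D₂, field fun x _ => (0, x), field fun x y => (0, y + x * Real.log x)]) ∧
      (∀ T₁ T₂, T₁ ≠ 0 → HasKillingBasis (N46 T₁ T₂) ![X, D₂])) ∧
    -- N₅⁶
    (HasKillingBasis (N56 0 0)
        ![X, D₂, field fun _ y => (0, y), field fun x y => (x * y, 0),
          field fun x _ => (0, Real.log x), field fun x _ => (x * Real.log x, 0)] ∧
      (∀ T₂, T₂ ≠ 0 → HasKillingBasis (N56 0 T₂)
        ![X, D₂, field fun _ y => (0, y), field fun x _ => (0, Real.log x)]) ∧
      (∀ T₁ T₂, T₁ ≠ 0 → HasKillingBasis (N56 T₁ T₂) ![X, D₂])) ∧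
    -- N₆⁶(c)
    (∀ c : ℝ, c ≠ 0 → c ≠ -1 →
      HasKillingBasis (N66 c 0 0)
        ![X, D₂, field fun _ y => (0, y), field fun x _ => (x ^ (-c), 0),
          field fun x y => (x ^ (-c) * y, 0), field fun x _ => (0, x ^ (c + 1))] ∧
      (∀ T₂, T₂ ≠ 0 → HasKillingBasis (N66 c 0 T₂)
        ![X, D₂, field fun _ y => (0, y), field fun x _ => (0, x ^ (c + 1))]) ∧
      (∀ T₁ T₂, T₁ ≠ 0 → HasKillingBasis (N66 c T₁ T₂) ![X, D₂])) ∧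
    -- N₁⁴(κ)
    (∀ κ : ℝ, κ ≠ 0 → κ ≠ -1 →
      (∀ T₂, HasKillingBasis (N14 κ 0 T₂)
        ![X, D₂, field fun x _ => (0, x), field fun x _ => (x, x * -Real.log x)]) ∧
      (∀ T₁ T₂, T₁ ≠ 0 → HasKillingBasis (N14 κ T₁ T₂) ![X, D₂])) ∧
    -- N₂⁴(κ, θ)
    (∀ κ θ : ℝ, θ ≠ 0 → κ * (κ + θ) ≠ 0 →
      (∀ T₂, HasKillingBasis (N24 κ θ 0 T₂)
        ![X, D₂, field fun _ y => (0, y), field fun x _ => (0, x ^ θ)]) ∧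
      (∀ T₁ T₂, T₁ ≠ 0 → HasKillingBasis (N24 κ θ T₁ T₂) ![X, D₂])) ∧
    -- N₃⁴(c)
    (∀ c : ℝ, c ≠ 0 →
      (∀ T₂, HasKillingBasis (N34 c 0 T₂)
        ![X, D₂, field fun _ y => (0, y), field fun x _ => (0, Real.log x)]) ∧
      (∀ T₁ T₂, T₁ ≠ 0 → HasKillingBasis (N34 c T₁ T₂) ![X, D₂])) ∧
    -- N₁³(±)
    (∀ ε : ℝ, (ε = 1 ∨ ε = -1) →
      (∀ T₁, HasKillingBasis (N13 ε T₁ 0)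
        ![X, D₂, field fun x y => (y * (2 * x), y * y)]) ∧
      (∀ T₁ T₂, T₂ ≠ 0 → HasKillingBasis (N13 ε T₁ T₂) ![X, D₂])) ∧
    -- N₂³(c)
    (∀ c : ℝ,
      (∀ T₁, HasKillingBasis (N23 c T₁ 0)
        ![X, D₂, field fun x y => (y * (2 * x), y * y)]) ∧
      (∀ T₁ T₂, T₂ ≠ 0 → HasKillingBasis (N23 c T₁ T₂) ![X, D₂])) ∧
    -- N₃³, the Lorentzian hyperbolic plane
    (HasKillingBasis (N33 0 0) ![X, D₂, field fun x y => (2 * x * y, y ^ 2 + x ^ 2)] ∧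
      (∀ T₁ T₂, (T₁, T₂) ≠ (0, 0) → HasKillingBasis (N33 T₁ T₂) ![X, D₂])) ∧
    -- N₄³, the hyperbolic plane
    (HasKillingBasis (N43 0 0) ![X, D₂, field fun x y => (2 * x * y, y ^ 2 - x ^ 2)] ∧
      (∀ T₁ T₂, (T₁, T₂) ≠ (0, 0) → HasKillingBasis (N43 T₁ T₂) ![X, D₂])) := by
  have fib : ∀ {p q r s m n u : ℝ}, u ≠ 0 → ∀ a b c d,
      frameOf a b c d ∈ reducedSpan (model p q r s m n 0 u) → a = 0 ∧ c = 0 :=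
    fun hu _ _ _ _ hE => (isProlonged_reducedSpan _).of_torsion_one_eq_zero hu hE
  have nonflat : ∀ {p q s u : ℝ}, s ≠ 0 → s - p - 1 ≠ 0 → ∀ a b c d,
      frameOf a b c d ∈ reducedSpan (model p q 0 s 0 0 0 u) → a = 0 ∧ c = 0 :=
    fun hs hp _ _ _ _ hE => (isProlonged_reducedSpan _).of_fibred_nonflat hs hp hE
  have min : ∀ A : Coeffs, (¬ ∃ B, IsListed B ∧ LinearlyEquivalent A B) →
      HasKillingBasis A ![X, D₂] := fun _ => hasKillingBasis_of_not_classified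
  refine ⟨fun A hA => ?_, min, ?_, ?_, ?_, ?_, ?_, ?_, ?_, ?_, ?_, ?_, ?_, ?_, ?_, ?_⟩
  · by_contra h
    exact absurd (rank_killing_le (min A h)) (not_le.2 (by exact_mod_cast hA))
  · simp only [N06_eq]
    exact ⟨hasKillingBasis_flat, fun T₂ h => hasKillingBasis_x_y (fib h),
      fun T₁ T₂ h => hasKillingBasis_of_fibred_torsion h (by norm_num)⟩
  · intro ε hε
    simp only [N16_eq]
    refine ⟨hasKillingBasis_quadric hε, fun T₁ T₂ h => hasKillingBasis_of_eq_bot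
      ((isProlonged_reducedSpan _).eq_bot_of_quadric ?_ ?_)⟩
    · rcases hε with rfl | rfl <;> norm_num
    · by_contra! h'
      exact h (by rw [h'.1, h'.2])
  · intro c hc
    simp only [N26_eq]
    have e : -1 + -c + 2 * c = -1 + c := by ring
    refine ⟨hasKillingBasis_powNeg hc, fun T₂ h => ?_, ?_, fun T₁ T₂ h h' => ?_⟩
    · rw [← e]
      exact hasKillingBasis_powX (neg_ne_zero.2 hc) (fib h)
    · rintro rfl T₁ h
      rw [show (-1 : ℝ) + -(1 / 2) = -(3 / 2) by norm_num]
      exact hasKillingBasis_three (fun a b d hE =>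
        (isProlonged_reducedSpan _).of_fibred_torsion h hE) (isKillingElem_half_one T₁)
        (by simp [Elem.diff, Elem.eval])
    · exact hasKillingBasis_of_fibred_torsion h fun ⟨h1, _, h3⟩ => h' ⟨h1, by linarith⟩
  · simp only [N36_eq]
    exact ⟨hasKillingBasis_shearNeg, fun T₂ h => hasKillingBasis_yxlogX (fib h),
      fun T₁ T₂ h => hasKillingBasis_of_fibred_torsion h (by norm_num)⟩
  · simp only [N46_eq]
    exact ⟨hasKillingBasis_shear, fun T₂ h => hasKillingBasis_yxlogX (fib h),
      fun T₁ T₂ h => hasKillingBasis_of_fibred_torsion h (by norm_num)⟩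
  · simp only [N56_eq]
    exact ⟨hasKillingBasis_log, fun T₂ h => hasKillingBasis_logX (fib h),
      fun T₁ T₂ h => hasKillingBasis_of_fibred_torsion h (by norm_num)⟩
  · intro c _ hc
    simp only [N66_eq]
    have e : -1 + (c + 1) + 2 * 0 = c := by ring
    have hc' : c + 1 ≠ 0 := fun h => hc (by linarith)
    refine ⟨hasKillingBasis_pow hc, fun T₂ h => ?_,
      fun T₁ T₂ h => hasKillingBasis_of_fibred_torsion h (by norm_num)⟩
    have := hasKillingBasis_powX (s := 0) (u := T₂) hc' (fib h)
    rwa [e] at this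
  · intro κ h0 h1
    simp only [N14_eq]
    refine ⟨fun T₂ => hasKillingBasis_xxlogX (nonflat h0 fun h => h1 (by linarith)),
      fun T₁ T₂ h => hasKillingBasis_of_fibred_torsion h fun ⟨h2, h3, _⟩ => ?_⟩
    linarith
  · intro κ θ hθ hκ
    simp only [N24_eq]
    obtain ⟨h0, h1⟩ := mul_ne_zero_iff.1 hκ
    refine ⟨fun T₂ => hasKillingBasis_powX hθ (nonflat h0 fun h => h1 (by linarith)),
      fun T₁ T₂ h => hasKillingBasis_of_fibred_torsion h fun ⟨h2, h3, _⟩ => h1 (by linarith)⟩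
  · intro c hc
    simp only [N34_eq]
    refine ⟨fun T₂ => hasKillingBasis_logX (nonflat hc fun h => hc (by linarith)),
      fun T₁ T₂ h => hasKillingBasis_of_fibred_torsion h fun ⟨h2, h3, _⟩ => ?_⟩
    linarith
  · intro ε hε
    simp only [N13_eq]
    have hm : (0 : ℝ) ≠ 0 ∨ ε * (1 / 2) ≠ 0 := Or.inr (by rcases hε with rfl | rfl <;> norm_num)
    exact ⟨fun T₁ => hasKillingBasis_half hm,
      fun T₁ T₂ h => hasKillingBasis_of_half_torsion hm h⟩
  · intro c
    simp only [N23_eq]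
    exact ⟨fun T₁ => hasKillingBasis_half (Or.inl one_ne_zero),
      fun T₁ T₂ h => hasKillingBasis_of_half_torsion (Or.inl one_ne_zero) h⟩
  · simp only [N33_eq]
    exact ⟨hasKillingBasis_three (of_hyperbolic_of_entry (by norm_num)) isKillingElem_lorentzian
      (by simp [Elem.diff, Elem.eval]),
      fun T₁ T₂ h => hasKillingBasis_of_hyperbolic_torsion (by norm_num) h⟩
  · simp only [N43_eq]
    exact ⟨hasKillingBasis_three (of_hyperbolic_of_entry (by norm_num)) isKillingElem_hyperbolic
      (by simp [Elem.diff, Elem.eval]),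
      fun T₁ T₂ h => hasKillingBasis_of_hyperbolic_torsion (by norm_num) h⟩
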